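/- **Setting.** Let $M=(m_1,\dots,m_n)$ with real $m_j\ge1$, $\min_j m_j=1$, and put $|M|=m_1+\dots+m_n$, $t^Mx=(t^{m_1}x_1,\dots,t^{m_n}x_n)$ for $t>0$, $x\in\mathbb R^n$. Let $[0]=0$ and, for $x\neq0$, let $[x]$ be the unique $t>0$ with $\sum_j (x_j/t^{m_j})^2=1$. Fix $\Psi\in C^\infty(\mathbb R)$ with $\Psi(t)=1$ for $0\le t\le\frac{11}{10}$ and $\Psi(t)=0$ for $t\ge\frac{13}{10}$; put $\Psi_j(\xi)=\Psi(2^{-j}[\xi])$ for $j\ge0$, $\Psi_{-1}=0$, $\Phi_j=\Psi_j-\Psi_{j-1}$ for $j\ge 0$. With $\mathcal Fu(\xi)=\int e^{-ix\cdot\xi}u(x)\,dx$, $s\in\mathbb R$ and $p,q\in(0,\infty]$, the spaces $B^{M,s}_{p,q}(\mathbb R^n)$ and (for $p<\infty$) $F^{M,s}_{p,q}(\mathbb R^n)$ consist of the tempered distributions $u$ for which the quasi-norm $$\big\|\{2^{sj}\|\mathcal F^{-1}\Phi_j\mathcal Fu\|_{L_p}\}_{j\ge0}\big\|_{\ell_q},\qquad\text{respectively}\qquad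 \Big\|\,\big\|\{2^{sj}\mathcal F^{-1}\Phi_j\mathcal Fu(\cdot)\}_{j\ge0}\big\|_{\ell_q}\Big\|_{L_p},$$ is finite. For tempered distributions $u,v$, the product $\pi(u,v)$ is the limit in $\mathcal D'(\mathbb R^n)$, as $k\to\infty$, of $\mathcal F^{-1}(\psi_k\mathcal Fu)\cdot\mathcal F^{-1}(\psi_k\mathcal Fv)$ with $\psi_k(\xi)=\psi(2^{-kM}\xi)$, provided that this limit exists for every $\psi\in C_0^\infty(\mathbb R^n)$ equal to $1$ near $0$ and does not depend on $\psi$. **Theorem.** For $j=0,1,2$ let $A_j$ be either $B^{M,s_j}_{p_j,q_j}(\mathbb R^n)$ or $F^{M,s_j}_{p_j,q_j}(\mathbb R^n)$ (independently of each other). Suppose there is a constant $c<\infty$ such that $$\|f\cdot g\|_{A_2}\le c\,\|f\|_{A_0}\|g\|_{A_1}\quad\text{for all } f,g\in\mathcal S(\mathbb R^n),$$ or, alternatively, such that this holds with $f\cdot g$ replaced by $\pi(f,g)$. Then, with $1/\infty=0$ and $1/0=\infty$: 1. $s_0+s_1\ge|M|\big(\frac1{p_0}+\frac1{p_1}-1\big)$;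 2. $s_0+s_1\ge0$; 3. $s_2\le\min(s_0,s_1)$; 4. $\frac1{p_2}\le\frac1{p_0}+\frac1{p_1}$; 5. $s_2-\frac{|M|}{p_2}\le\min\big(s_0-\frac{|M|}{p_0},\,s_1-\frac{|M|}{p_1}\big)$; 6. $s_2-\frac{|M|}{p_2}\le s_0+s_1-|M|\big(\frac1{p_0}+\frac1{p_1}\big)$; 7. if $s_2-\frac{|M|}{p_2}=s_1-\frac{|M|}{p_1}$ and $s_0=\frac{|M|}{p_0}$, then $q_0\le1$ when $A_0$ is a Besov space, and $p_0\le1$ when $A_0$ is a Triebel–Lizorkin space. Moreover: * (1′) if $s_0+s_1=\frac{|M|}{p_0}+\frac{|M|}{p_1}-|M|$, then $\frac1{q_0}+\frac1{q_1}\ge1$ when $A_0$ and $A_1$ are Besov spaces, and $\frac1{q_0}+\frac1{p_1}\ge1$ when $A_0$ is a Besov space and $A_1$ is a Triebel–Lizorkin space; * (2′) if $s_0+s_1=0$, then $\frac1{q_0}+\frac1{q_1}\ge1$; * (3′) for $j=0,1$: if $s_2=s_j$, then $q_2\ge q_j$; * (5′) for $j=0,1$: if $s_2-\frac{|M|}{p_2}=s_j-\frac{|M|}{p_j}$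 and $A_j$ and $A_2$ are Besov spaces, then $q_2\ge q_j$; * (6′) if $s_2-\frac{|M|}{p_2}=s_0-\frac{|M|}{p_0}+s_1-\frac{|M|}{p_1}$ and $A_0,A_1,A_2$ are all Besov spaces, then $q_2\ge\big(\frac1{q_0}+\frac1{q_1}\big)^{-1}$. -/

import Mathlib

open MeasureTheory Filter
open scoped SchwartzMap FourierTransform ContDiff ENNReal NNReal Topology

noncomputable section

/-! ### Anisotropic weights -/

/-- An anisotropic weight `M = (m₁, …, mₙ)`: real numbers `m_j ≥ 1` with `min_j m_j = 1`. -/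
structure AnisotropicWeight (n : ℕ) where
  m : Fin n → ℝ
  one_le : ∀ j, 1 ≤ m j
  exists_eq_one : ∃ j, m j = 1

namespace AnisotropicWeight

variable {n : ℕ} (M : AnisotropicWeight n)

/-- `|M| = m₁ + ⋯ + mₙ`. -/
def total : ℝ := ∑ j, M.m j

/-- The quasi-homogeneous dilation `x ↦ t^M x = (t^{m₁} x₁, …, t^{mₙ} xₙ)` for `t > 0`. -/
def dilation (t : ℝ) (ht : 0 < t) :
    EuclideanSpace ℝ (Fin n) ≃L[ℝ] EuclideanSpace ℝ (Fin n) :=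
  LinearEquiv.toContinuousLinearEquiv
    { toFun := fun x => WithLp.toLp 2 fun j => t ^ M.m j * x j
      invFun := fun x => WithLp.toLp 2 fun j => (t ^ M.m j)⁻¹ * x j
      map_add' := fun x y => by ext j; simp [mul_add]
      map_smul' := fun c x => by ext j; simp [mul_left_comm]
      left_inv := fun x => by
        ext j; simp [inv_mul_cancel_left₀ (Real.rpow_pos_of_pos ht (M.m j)).ne']
      right_inv := fun x => by
        ext j; simp [mul_inv_cancel_left₀ (Real.rpow_pos_of_pos ht (M.m j)).ne'] }

/-- The anisotropic distance `[x]`: `[0] = 0`, and for `x ≠ 0` the unique `t > 0` such that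
`∑ j, (x_j / t^{m_j})² = 1`. (For `x = 0` the set below is empty and its `sInf` is `0`; for `x ≠ 0`
it has exactly one element, see `size_spec` and `size_eq`.) -/
def size (x : EuclideanSpace ℝ (Fin n)) : ℝ :=
  sInf {t : ℝ | 0 < t ∧ ∑ j, (x j / t ^ M.m j) ^ 2 = 1}

theorem sum_le {x : EuclideanSpace ℝ (Fin n)} {t : ℝ} (ht : 1 ≤ t) :
    ∑ j, (x j / t ^ M.m j) ^ 2 ≤ ‖x‖ ^ 2 / t ^ 2 := by
  rw [EuclideanSpace.real_norm_sq_eq, Finset.sum_div]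
  refine Finset.sum_le_sum fun j _ => ?_
  rw [div_pow]
  have h1 : t ≤ t ^ M.m j := by
    simpa using Real.rpow_le_rpow_of_exponent_le ht (M.one_le j)
  gcongr

theorem le_sum {x : EuclideanSpace ℝ (Fin n)} {t : ℝ} (ht0 : 0 < t) (ht : t ≤ 1) :
    ‖x‖ ^ 2 / t ^ 2 ≤ ∑ j, (x j / t ^ M.m j) ^ 2 := by
  rw [EuclideanSpace.real_norm_sq_eq, Finset.sum_div]
  refine Finset.sum_le_sum fun j _ => ?_
  rw [div_pow]
  have h1 : t ^ M.m j ≤ t := by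
    simpa using Real.rpow_le_rpow_of_exponent_ge ht0 ht (M.one_le j)
  have h2 : 0 < t ^ M.m j := Real.rpow_pos_of_pos ht0 _
  gcongr

theorem sum_strictAnti {x : EuclideanSpace ℝ (Fin n)} (hx : x ≠ 0) {s t : ℝ} (hs : 0 < s)
    (hst : s < t) : ∑ j, (x j / t ^ M.m j) ^ 2 < ∑ j, (x j / s ^ M.m j) ^ 2 := by
  have hpow : ∀ j, s ^ M.m j < t ^ M.m j := fun j =>
    Real.rpow_lt_rpow hs.le hst (by linarith [M.one_le j])
  have hp : ∀ j, 0 < s ^ M.m j := fun j => Real.rpow_pos_of_pos hs _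
  obtain ⟨j, hj⟩ : ∃ j, x j ≠ 0 := by
    by_contra! h
    exact hx (by ext j; simpa using h j)
  refine Finset.sum_lt_sum (fun i _ => ?_) ⟨j, Finset.mem_univ _, ?_⟩
  · have := hp i
    have := hpow i
    rw [div_pow, div_pow]
    gcongr
  · have := hp j
    have := hpow j
    have : 0 < x j ^ 2 := by positivity
    rw [div_pow, div_pow]
    gcongr

theorem exists_size {x : EuclideanSpace ℝ (Fin n)} (hx : x ≠ 0) :
    ∃ t : ℝ, 0 < t ∧ ∑ j, (x j / t ^ M.m j) ^ 2 = 1 := by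
  have hx' : 0 < ‖x‖ := norm_pos_iff.mpr hx
  set a := min 1 ‖x‖
  set b := max 1 ‖x‖
  have ha : 0 < a := lt_min one_pos hx'
  have hab : a ≤ b := (min_le_left _ _).trans (le_max_left _ _)
  have hb : 0 < b := ha.trans_le hab
  have hc : ContinuousOn (fun t : ℝ => ∑ j, (x j / t ^ M.m j) ^ 2) (Set.Icc a b) := by
    refine continuousOn_finsetSum _ fun j _ => ContinuousOn.pow (ContinuousOn.div
      continuousOn_const ?_ ?_) 2
    · exact ContinuousOn.rpow_const continuousOn_id fun t ht => Or.inl (ha.trans_le ht.1).ne'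
    · exact fun t ht => (Real.rpow_pos_of_pos (ha.trans_le ht.1) _).ne'
  have h1 : 1 ≤ ∑ j, (x j / a ^ M.m j) ^ 2 := by
    refine le_trans ?_ (M.le_sum ha (min_le_left _ _))
    rw [one_le_div (by positivity)]
    gcongr
    exact min_le_right _ _
  have h2 : ∑ j, (x j / b ^ M.m j) ^ 2 ≤ 1 := by
    refine (M.sum_le (le_max_left _ _)).trans ?_
    rw [div_le_one (by positivity)]
    gcongr
    exact le_max_right _ _
  obtain ⟨t, ht, h⟩ := intermediate_value_Icc' hab hc ⟨h2, h1⟩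
  exact ⟨t, ha.trans_le ht.1, h⟩

theorem size_eq {x : EuclideanSpace ℝ (Fin n)} {t : ℝ} (ht : 0 < t)
    (h : ∑ j, (x j / t ^ M.m j) ^ 2 = 1) : M.size x = t := by
  have hx : x ≠ 0 := by
    rintro rfl
    simp at h
  have : {s : ℝ | 0 < s ∧ ∑ j, (x j / s ^ M.m j) ^ 2 = 1} = {t} := by
    ext s
    simp only [Set.mem_ofPred_eq, Set.mem_singleton_iff]
    refine ⟨fun hs => ?_, fun hs => hs ▸ ⟨ht, h⟩⟩
    rcases lt_trichotomy s t with hlt | heq | hlt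
    · have := M.sum_strictAnti hx hs.1 hlt
      linarith [hs.2]
    · exact heq
    · have := M.sum_strictAnti hx ht hlt
      linarith [hs.2]
  rw [size, this, csInf_singleton]

theorem size_spec {x : EuclideanSpace ℝ (Fin n)} (hx : x ≠ 0) :
    0 < M.size x ∧ ∑ j, (x j / M.size x ^ M.m j) ^ 2 = 1 := by
  obtain ⟨t, ht, h⟩ := M.exists_size hx
  rw [M.size_eq ht h]
  exact ⟨ht, h⟩

theorem size_zero : M.size 0 = 0 := by
  simp [size]

theorem size_le_one {x : EuclideanSpace ℝ (Fin n)} (hx : ‖x‖ < 1) : M.size x ≤ 1 := by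
  by_cases h0 : x = 0
  · simp [h0, size_zero]
  by_contra! h
  have h1 := (M.size_spec h0).2
  have h2 := M.sum_le (x := x) h.le
  rw [h1, one_le_div (by positivity)] at h2
  have h3 := abs_le_of_sq_le_sq h2 (norm_nonneg x)
  have := le_abs_self (M.size x)
  linarith

theorem abs_le_of_size_le {x : EuclideanSpace ℝ (Fin n)} {T : ℝ} (h : M.size x ≤ T)
    (j : Fin n) : |x j| ≤ T ^ M.m j := by
  by_cases h0 : x = 0
  · have : 0 ≤ T := by simpa [h0, size_zero] using h
    simp only [h0, PiLp.zero_apply, abs_zero]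
    positivity
  obtain ⟨hp, hs⟩ := M.size_spec h0
  have h1 : (x j / M.size x ^ M.m j) ^ 2 ≤ 1 := by
    rw [← hs]
    exact Finset.single_le_sum (f := fun j => (x j / M.size x ^ M.m j) ^ 2)
      (fun i _ => sq_nonneg _) (Finset.mem_univ j)
  have hq : 0 < M.size x ^ M.m j := Real.rpow_pos_of_pos hp _
  have h2 : |x j / M.size x ^ M.m j| ≤ 1 := by
    rwa [← sq_le_one_iff_abs_le_one]
  rw [abs_div, abs_of_pos hq, div_le_one hq] at h2
  exact h2.trans (Real.rpow_le_rpow hp.le h (by linarith [M.one_le j]))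

theorem contDiffAt_size {x₀ : EuclideanSpace ℝ (Fin n)} (hx : x₀ ≠ 0) :
    ContDiffAt ℝ ∞ M.size x₀ := by
  obtain ⟨ht, hs⟩ := M.size_spec hx
  set t₀ := M.size x₀
  let f : EuclideanSpace ℝ (Fin n) × ℝ → ℝ := fun v => ∑ j, (v.1 j / v.2 ^ M.m j) ^ 2
  have hf : ContDiffAt ℝ ∞ f (x₀, t₀) := by
    refine ContDiffAt.sum fun j _ => ContDiffAt.pow (ContDiffAt.div ?_ ?_ ?_) 2
    · fun_prop
    · exact ContDiffAt.rpow_const_of_ne contDiffAt_snd ht.ne'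
    · exact (Real.rpow_pos_of_pos ht _).ne'
  have hd : HasDerivAt (fun t => f (x₀, t))
      (∑ j, -(2 * M.m j / t₀ * (x₀ j / t₀ ^ M.m j) ^ 2)) t₀ := by
    refine HasDerivAt.fun_sum fun j _ => ?_
    have hp : t₀ ^ M.m j ≠ 0 := (Real.rpow_pos_of_pos ht _).ne'
    have h1 := (((hasDerivAt_const t₀ (x₀ j)).div
      (Real.hasDerivAt_rpow_const (p := M.m j) (Or.inl ht.ne')) hp).pow 2)
    refine h1.congr_deriv ?_
    rw [Real.rpow_sub_one ht.ne']
    simp only [Pi.div_apply]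
    generalize t₀ ^ M.m j = a at hp
    have := ht.ne'
    field_simp
    norm_num
    field_simp
  have hneg : (∑ j, -(2 * M.m j / t₀ * (x₀ j / t₀ ^ M.m j) ^ 2)) ≠ 0 := by
    rw [Finset.sum_neg_distrib]
    have : 2 / t₀ ≤ ∑ j, (2 * M.m j / t₀ * (x₀ j / t₀ ^ M.m j) ^ 2) := by
      calc 2 / t₀ = ∑ j, (2 / t₀ * (x₀ j / t₀ ^ M.m j) ^ 2) := by
            rw [← Finset.mul_sum, hs, mul_one]
        _ ≤ _ := by
            refine Finset.sum_le_sum fun j _ => ?_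
            have := M.one_le j
            gcongr
            linarith
    have : 0 < 2 / t₀ := by positivity
    linarith
  have hn : (∞ : WithTop ℕ∞) ≠ 0 := by simp
  have hcomp : HasDerivAt (fun t => f (x₀, t))
      ((fderiv ℝ f (x₀, t₀) ∘L .inr ℝ (EuclideanSpace ℝ (Fin n)) ℝ) 1) t₀ := by
    have h1 : HasFDerivAt f (fderiv ℝ f (x₀, t₀)) (x₀, t₀) :=
      (hf.differentiableAt hn).hasFDerivAt
    exact (h1.comp t₀ (hasFDerivAt_prodMk_right x₀ t₀)).hasDerivAt
  have hone := hcomp.unique hd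
  have hinv : (fderiv ℝ f (x₀, t₀) ∘L .inr ℝ (EuclideanSpace ℝ (Fin n)) ℝ).IsInvertible := by
    set L := fderiv ℝ f (x₀, t₀) ∘L .inr ℝ (EuclideanSpace ℝ (Fin n)) ℝ
    refine ⟨ContinuousLinearEquiv.unitsEquivAut ℝ (Units.mk0 (L 1) (hone ▸ hneg)), ?_⟩
    ext
    simp
  have hg := hf.contDiffAt_implicitFunction hn hinv
  refine hg.congr_of_eventuallyEq ?_
  have h1 := hf.eventually_apply_implicitFunction hn hinv
  have h2 : ∀ᶠ x in 𝓝 x₀, 0 < hf.implicitFunction hn hinv x := by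
    refine hg.continuousAt.eventually_const_lt ?_
    have := hf.implicitFunction_apply_self hn hinv
    simp only at this
    rw [this]
    exact ht
  filter_upwards [h1, h2] with x hx1 hx2
  exact M.size_eq hx2 (hx1.trans hs)

end AnisotropicWeight

/-! ### The dyadic partition of unity -/

/-- A smooth function `Ψ` on `ℝ` with `Ψ(t) = 1` for `0 ≤ t ≤ 11/10` and `Ψ(t) = 0` for
`t ≥ 13/10`. -/
structure DyadicCutoff where
  toFun : ℝ → ℂ
  smooth : ContDiff ℝ ∞ toFun
  eq_one : ∀ t, 0 ≤ t → t ≤ 11 / 10 → toFun t = 1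
  eq_zero : ∀ t, 13 / 10 ≤ t → toFun t = 0

namespace DyadicCutoff

variable {n : ℕ} (Ψ : DyadicCutoff) (M : AnisotropicWeight n)

/-- `Ψ_j(ξ) = Ψ(2^{-j} [ξ])` for `j ≥ 0`, and `Ψ_j = 0` for `j < 0`. -/
def low (j : ℤ) (ξ : EuclideanSpace ℝ (Fin n)) : ℂ :=
  if 0 ≤ j then Ψ.toFun ((2 : ℝ) ^ (-j) * M.size ξ) else 0

/-- `Φ_j = Ψ_j - Ψ_{j-1}`. -/
def dyadic (j : ℤ) (ξ : EuclideanSpace ℝ (Fin n)) : ℂ :=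
  Ψ.low M j ξ - Ψ.low M (j - 1) ξ

theorem low_contDiff (j : ℤ) : ContDiff ℝ ∞ (Ψ.low M j) := by
  by_cases hj : 0 ≤ j
  · have h2 : (2 : ℝ) ^ (-j) ≤ 1 := zpow_le_one_of_nonpos₀ (by norm_num) (by omega)
    have h2' : (0 : ℝ) < 2 ^ (-j) := by positivity
    rw [contDiff_iff_contDiffAt]
    intro ξ
    by_cases h0 : ξ = 0
    · subst h0
      refine (contDiffAt_const (c := (1 : ℂ))).congr_of_eventuallyEq ?_
      filter_upwards [Metric.ball_mem_nhds _ one_pos] with x hx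
      have h1 : M.size x ≤ 1 := M.size_le_one (by simpa using hx)
      have h3 : 0 ≤ M.size x := by
        by_cases hx0 : x = 0
        · simp [hx0, M.size_zero]
        · exact (M.size_spec hx0).1.le
      simp only [low, if_pos hj]
      exact Ψ.eq_one _ (by positivity) (by nlinarith)
    · have : Ψ.low M j = fun ξ => Ψ.toFun ((2 : ℝ) ^ (-j) * M.size ξ) := by
        ext ξ; simp [low, hj]
      rw [this]
      exact (Ψ.smooth.contDiffAt).comp ξ (contDiffAt_const.mul (M.contDiffAt_size h0))
  · have : Ψ.low M j = fun _ => 0 := by ext ξ; simp [low, hj]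
    rw [this]
    exact contDiff_const

theorem low_hasCompactSupport (j : ℤ) : HasCompactSupport (Ψ.low M j) := by
  refine HasCompactSupport.of_support_subset_isCompact
    (K := Metric.closedBall 0 √(∑ i, (((13 / 10 : ℝ) * 2 ^ j) ^ M.m i) ^ 2))
    (isCompact_closedBall _ _) fun ξ hξ => ?_
  have hlt : M.size ξ ≤ (13 / 10 : ℝ) * 2 ^ j := by
    by_contra! h
    apply hξ
    by_cases hj : 0 ≤ j
    · simp only [low, if_pos hj]
      apply Ψ.eq_zero
      rw [zpow_neg, inv_mul_eq_div, le_div_iff₀ (by positivity)]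
      exact h.le
    · simp [low, hj]
  rw [mem_closedBall_zero_iff, EuclideanSpace.norm_eq]
  apply Real.sqrt_le_sqrt
  refine Finset.sum_le_sum fun i _ => ?_
  have := M.abs_le_of_size_le hlt i
  rw [Real.norm_eq_abs]
  gcongr

/-- `Φ_j`, as a Schwartz function. -/
def dyadicSchwartz (j : ℕ) : 𝓢(EuclideanSpace ℝ (Fin n), ℂ) :=
  HasCompactSupport.toSchwartzMap (f := Ψ.dyadic M j)
    ((Ψ.low_hasCompactSupport M j).sub (Ψ.low_hasCompactSupport M (j - 1)))
    ((Ψ.low_contDiff M j).sub (Ψ.low_contDiff M (j - 1)))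

end DyadicCutoff

/-! ### Frequency localisation `𝓕⁻¹ χ 𝓕 u`

With the Fourier transform `û(ξ) = ∫ e^{-i x·ξ} u(x) dx`, the distribution `𝓕⁻¹(χ û)` is, for
`χ ∈ C₀^∞`, the smooth function `x ↦ (2π)^{-n} ⟨û, e^{i x·} χ⟩`. In terms of Mathlib's Fourier
transform `𝓕 u (η) = ∫ e^{-2πi x·η} u(x) dx = û(2πη)`, this is
`x ↦ ⟨𝓕 u, e^{2πi x·} χ(2π·)⟩`. -/

section Localisation

variable {n : ℕ}

/-- Multiplication by `2π` on `ℝⁿ`. -/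
def twoPiScaling (n : ℕ) : EuclideanSpace ℝ (Fin n) ≃L[ℝ] EuclideanSpace ℝ (Fin n) :=
  ContinuousLinearEquiv.smulLeft (Units.mk0 (2 * Real.pi) Real.two_pi_pos.ne')

theorem planeWave_hasTemperateGrowth (x : EuclideanSpace ℝ (Fin n)) :
    Function.HasTemperateGrowth fun η : EuclideanSpace ℝ (Fin n) =>
      Complex.exp (2 * Real.pi * Complex.I * (inner ℝ x η : ℝ)) := by
  have h : Function.HasTemperateGrowth fun t : ℝ => Complex.exp (2 * Real.pi * Complex.I * t) := by
    refine ⟨contDiff_const.mul Complex.ofRealCLM.contDiff |>.cexp, fun k => ⟨0, (2 * Real.pi) ^ k, fun t => ?_⟩⟩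
    rw [norm_iteratedFDeriv_eq_norm_iteratedDeriv]
    have : ∀ k : ℕ, iteratedDeriv k (fun t : ℝ => Complex.exp (2 * Real.pi * Complex.I * t)) =
        fun t : ℝ => (2 * Real.pi * Complex.I) ^ k * Complex.exp (2 * Real.pi * Complex.I * t) := by
      intro k
      induction k with
      | zero => simp
      | succ k ih =>
        rw [iteratedDeriv_succ, ih]
        ext t
        have h1 : HasDerivAt (fun t : ℝ => (2 * Real.pi * Complex.I) * (t : ℂ))
            (2 * Real.pi * Complex.I) t := by
          simpa using (Complex.ofRealCLM.hasDerivAt (x := t)).const_mul (2 * Real.pi * Complex.I)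
        rw [(h1.cexp.const_mul _).deriv]
        ring
    rw [this k]
    have h2 : (2 * Real.pi * Complex.I * t : ℂ) = ((2 * Real.pi * t : ℝ) : ℂ) * Complex.I := by
      push_cast; ring
    beta_reduce
    rw [norm_mul, h2, Complex.norm_exp_ofReal_mul_I]
    simp [abs_of_pos Real.pi_pos]
  exact h.comp (Function.hasTemperateGrowth_inner_right x)

/-- The Schwartz function `η ↦ e^{2πi x·η} χ(2πη)`. -/
def waveTest (χ : 𝓢(EuclideanSpace ℝ (Fin n), ℂ)) (x : EuclideanSpace ℝ (Fin n)) :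
    𝓢(EuclideanSpace ℝ (Fin n), ℂ) :=
  SchwartzMap.smulLeftCLM ℂ (fun η => Complex.exp (2 * Real.pi * Complex.I * (inner ℝ x η : ℝ)))
    (SchwartzMap.compCLMOfContinuousLinearEquiv ℂ (twoPiScaling n) χ)

theorem waveTest_apply (χ : 𝓢(EuclideanSpace ℝ (Fin n), ℂ)) (x η : EuclideanSpace ℝ (Fin n)) :
    waveTest χ x η =
      Complex.exp (2 * Real.pi * Complex.I * (inner ℝ x η : ℝ)) * χ ((2 * Real.pi) • η) := by
  rw [waveTest, SchwartzMap.smulLeftCLM_apply_apply (planeWave_hasTemperateGrowth x)]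
  rfl

/-- The function `𝓕⁻¹ χ 𝓕 u` for a tempered distribution `u`. -/
def bandPart (χ : 𝓢(EuclideanSpace ℝ (Fin n), ℂ)) (u : 𝓢'(EuclideanSpace ℝ (Fin n), ℂ))
    (x : EuclideanSpace ℝ (Fin n)) : ℂ :=
  𝓕 u (waveTest χ x)

end Localisation

/-! ### Besov and Triebel–Lizorkin spaces -/

/-- The (quasi-)norm of `ℓ_q(ℕ₀)`, `0 < q ≤ ∞`, of a sequence of non-negative numbers. -/
def ellNorm (q : ℝ≥0∞) (a : ℕ → ℝ≥0∞) : ℝ≥0∞ :=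
  if q = ⊤ then ⨆ j, a j else (∑' j, a j ^ q.toReal) ^ (1 / q.toReal)

/-- The two scales: Besov (`B`) and Triebel–Lizorkin (`F`). -/
inductive Scale where
  | B
  | F

/-- The parameters of an anisotropic space `B^{M,s}_{p,q}` or `F^{M,s}_{p,q}`: `s ∈ ℝ` and
`p, q ∈ (0, ∞]`, where `p < ∞` in the Triebel–Lizorkin case. -/
structure SpaceParams where
  scale : Scale
  s : ℝ
  p : ℝ≥0∞
  q : ℝ≥0∞
  p_pos : 0 < p
  q_pos : 0 < q
  p_lt_top : scale = Scale.F → p < ⊤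

/-- The real number `1/p`, with `1/∞ = 0`. -/
def SpaceParams.recip (A : SpaceParams) : ℝ := (A.p⁻¹).toReal

/-- The (quasi-)norm of a tempered distribution in `B^{M,s}_{p,q}(ℝⁿ)` or `F^{M,s}_{p,q}(ℝⁿ)`; the
space consists of the tempered distributions for which it is finite. -/
def spaceNorm {n : ℕ} (M : AnisotropicWeight n) (Ψ : DyadicCutoff) (A : SpaceParams)
    (u : 𝓢'(EuclideanSpace ℝ (Fin n), ℂ)) : ℝ≥0∞ :=
  match A.scale with
  | Scale.B => ellNorm A.q fun j =>
      (2 : ℝ≥0∞) ^ (A.s * j) * eLpNorm (bandPart (Ψ.dyadicSchwartz M j) u) A.p volume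
  | Scale.F => eLpNorm (fun x => ellNorm A.q fun j =>
      (2 : ℝ≥0∞) ^ (A.s * j) * ‖bandPart (Ψ.dyadicSchwartz M j) u x‖ₑ) A.p volume

/-! ### Products -/

/-- The pointwise product `f · g` of two Schwartz functions. -/
def schwartzMul {n : ℕ} (f g : 𝓢(EuclideanSpace ℝ (Fin n), ℂ)) :
    𝓢(EuclideanSpace ℝ (Fin n), ℂ) :=
  SchwartzMap.pairing (ContinuousLinearMap.mul ℂ ℂ) f g

theorem schwartzMul_apply {n : ℕ} (f g : 𝓢(EuclideanSpace ℝ (Fin n), ℂ))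
    (x : EuclideanSpace ℝ (Fin n)) : schwartzMul f g x = f x * g x := rfl

/-- `IsProduct M u v w` says that the product `π(u, v)` is defined and equal to `w`: for every
`ψ ∈ C₀^∞(ℝⁿ)` that equals `1` on a neighbourhood of `0`, the functions
`𝓕⁻¹(ψ_k 𝓕 u) · 𝓕⁻¹(ψ_k 𝓕 v)`, where `ψ_k(ξ) = ψ(2^{-kM} ξ)`, converge to `w` in the space of
distributions as `k → ∞`. -/
def IsProduct {n : ℕ} (M : AnisotropicWeight n) (u v w : 𝓢'(EuclideanSpace ℝ (Fin n), ℂ)) : Prop :=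
  ∀ ψ : 𝓢(EuclideanSpace ℝ (Fin n), ℂ), HasCompactSupport ψ → (∀ᶠ ξ in 𝓝 0, ψ ξ = 1) →
    ∀ φ : 𝓢(EuclideanSpace ℝ (Fin n), ℂ), HasCompactSupport φ →
      Tendsto
        (fun k : ℕ =>
          let ψk := SchwartzMap.compCLMOfContinuousLinearEquiv ℂ
            (M.dilation ((2 : ℝ) ^ (-(k : ℤ))) (by positivity)) ψ
          ∫ x, bandPart ψk u x * bandPart ψk v x * φ x)
        atTop (𝓝 (w φ))

end

noncomputable section

/-! ### Dyadic dilations -/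

namespace AnisotropicWeight

variable {n : ℕ} (M : AnisotropicWeight n)

/-! Every condition comes from inserting explicit Schwartz functions into the estimate and comparing
growth rates of the two sides (`MulBound.exponent_le`). For Schwartz functions `π(f, g)` is the
ordinary product (`isProduct_schwartzMul`), so both forms of the hypothesis give the same estimate
`MulBound`.

All test functions are built from one function `f` with spectrum in a small ball at the origin
(`exists_base`). Let `e` be a unit vector of weight one. The modulated block `e^{iσ2^k e·x} f(x)`
has norm `2^{sk}‖f‖_p`, and the concentrated block, which is `e^{iσe·x} f(x)` dilated by `2^{kM}`,
has norm `2^{(s-|M|/p)k}‖f‖_p`. These formulas are exact because for `σ = ±1` each spectrum lies in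
a set `core k` where `Φ_k = 1` and every other `Φ_j` vanishes. Conditions (1)–(6) use pairs of
single functions. Opposite modulations multiply to `f²`, giving (2). A modulated block times `f`
gives (3), and spreading `f` out gives (4). A concentrated block times a function nonzero at 0 gives
(5), and the square of a concentrated block gives (6). Oppositely modulated concentrated blocks
leave a low-frequency part of size about `2^{-k|M|}`, giving (1).

The primed conditions and (7) use sums of `N` normalised blocks. Their norm is `N^{1/q}` for
modulated blocks in both scales, since all blocks have the same modulus, and for concentrated blocks
in the Besov scale. In the Triebel–Lizorkin scale concentrated blocks give at most a multiple of
`N^{1/p}`: at each point the sequence of blocks is dominated by one that has a single peak, so `q`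
has no influence (`exists_spaceNorm_dilSum_triebel_le`). When two lacunary sums are multiplied,
off-diagonal terms stay in the bands of the sum's own frequencies (`bandPart_mul_blockSum`), so
another band, such as band 0, sees only the diagonal. For (7), blocks that add up to `N f(0)` at the
origin multiply one block concentrated so strongly that it sees only this value. -/

theorem total_nonneg : 0 ≤ M.total :=
  Finset.sum_nonneg fun j _ => by linarith [M.one_le j]

theorem total_pos : 0 < M.total := by
  obtain ⟨j, hj⟩ := M.exists_eq_one
  exact Finset.sum_pos (fun i _ => by linarith [M.one_le i]) ⟨j, Finset.mem_univ j⟩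

/-- The dilation `x ↦ 2^{kM} x`. -/
def dyadicDilation (k : ℤ) : EuclideanSpace ℝ (Fin n) ≃L[ℝ] EuclideanSpace ℝ (Fin n) :=
  M.dilation ((2 : ℝ) ^ k) (by positivity)

theorem dyadicDilation_apply (k : ℤ) (x : EuclideanSpace ℝ (Fin n)) (j : Fin n) :
    M.dyadicDilation k x j = ((2 : ℝ) ^ k) ^ M.m j * x j := rfl

theorem dyadicDilation_add (k l : ℤ) (x : EuclideanSpace ℝ (Fin n)) :
    M.dyadicDilation (k + l) x = M.dyadicDilation k (M.dyadicDilation l x) := by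
  ext j
  simp only [dyadicDilation_apply]
  rw [zpow_add₀ two_ne_zero, Real.mul_rpow (by positivity) (by positivity), mul_assoc]

theorem dyadicDilation_zero (x : EuclideanSpace ℝ (Fin n)) : M.dyadicDilation 0 x = x := by
  ext j
  simp [dyadicDilation_apply]

theorem dyadicDilation_neg_cancel (k : ℤ) (x : EuclideanSpace ℝ (Fin n)) :
    M.dyadicDilation (-k) (M.dyadicDilation k x) = x := by
  rw [← dyadicDilation_add, neg_add_cancel, dyadicDilation_zero]

theorem dyadicDilation_cancel_neg (k : ℤ) (x : EuclideanSpace ℝ (Fin n)) :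
    M.dyadicDilation k (M.dyadicDilation (-k) x) = x := by
  rw [← dyadicDilation_add, add_neg_cancel, dyadicDilation_zero]

/-- The dilation is diagonal, hence self-adjoint; this is why dilating a function by `2^{kM}`
dilates its spectrum by the same map. -/
theorem inner_dyadicDilation (k : ℤ) (x y : EuclideanSpace ℝ (Fin n)) :
    inner ℝ (M.dyadicDilation k x) y = inner ℝ x (M.dyadicDilation k y) := by
  simp only [PiLp.inner_apply, dyadicDilation_apply]
  refine Finset.sum_congr rfl fun j _ => ?_
  simp only [RCLike.inner_apply, conj_trivial]
  ring

theorem size_nonneg (x : EuclideanSpace ℝ (Fin n)) : 0 ≤ M.size x := by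
  by_cases h : x = 0
  · simp [h, M.size_zero]
  · exact (M.size_spec h).1.le

theorem size_dyadicDilation (k : ℤ) (x : EuclideanSpace ℝ (Fin n)) :
    M.size (M.dyadicDilation k x) = 2 ^ k * M.size x := by
  by_cases h : x = 0
  · simp [h, M.size_zero]
  obtain ⟨h1, h2⟩ := M.size_spec h
  refine M.size_eq (by positivity) ?_
  rw [← h2]
  refine Finset.sum_congr rfl fun j _ => ?_
  rw [dyadicDilation_apply, Real.mul_rpow (by positivity) h1.le, mul_div_mul_left]
  positivity

theorem size_neg (x : EuclideanSpace ℝ (Fin n)) : M.size (-x) = M.size x := by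
  simp [size, neg_div]

/-- All weights are at least one and `2^k ≤ 1`, so each coordinate shrinks at least as much as under
the isotropic dilation. This lets low frequencies count as small errors at a higher scale. -/
theorem norm_dyadicDilation_le {k : ℤ} (hk : k ≤ 0) (x : EuclideanSpace ℝ (Fin n)) :
    ‖M.dyadicDilation k x‖ ≤ 2 ^ k * ‖x‖ := by
  have h2 : (0 : ℝ) ≤ 2 ^ k := by positivity
  rw [← abs_of_nonneg h2, ← Real.norm_eq_abs, ← norm_smul]
  rw [EuclideanSpace.norm_eq, EuclideanSpace.norm_eq]
  apply Real.sqrt_le_sqrt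
  refine Finset.sum_le_sum fun j _ => ?_
  have h3 : ((2 : ℝ) ^ k) ^ M.m j ≤ 2 ^ k := by
    simpa using Real.rpow_le_rpow_of_exponent_ge (by positivity : (0 : ℝ) < 2 ^ k)
      (zpow_le_one_of_nonpos₀ (by norm_num) hk) (M.one_le j)
  rw [dyadicDilation_apply, PiLp.smul_apply, smul_eq_mul, norm_mul, norm_mul]
  gcongr
  rw [Real.norm_of_nonneg (by positivity), Real.norm_of_nonneg h2]
  exact h3

theorem det_dyadicDilation (k : ℤ) :
    LinearMap.det (M.dyadicDilation k : EuclideanSpace ℝ (Fin n) →ₗ[ℝ] EuclideanSpace ℝ (Fin n)) =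
      2 ^ (k * M.total) := by
  set b := (EuclideanSpace.basisFun (Fin n) ℝ).toBasis
  have h : (M.dyadicDilation k : EuclideanSpace ℝ (Fin n) →ₗ[ℝ] EuclideanSpace ℝ (Fin n)) =
      Matrix.toLin b b (Matrix.diagonal fun j => ((2 : ℝ) ^ k) ^ M.m j) := by
    refine b.ext fun i => ?_
    rw [Matrix.toLin_self]
    ext j
    simp only [b, OrthonormalBasis.coe_toBasis, EuclideanSpace.basisFun_apply]
    change M.dyadicDilation k (EuclideanSpace.single i 1) j = _
    rw [dyadicDilation_apply]
    simp [Matrix.diagonal_apply]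
    split_ifs with hij <;> simp [hij]
  rw [h, LinearMap.det_toLin, Matrix.det_diagonal, ← Real.rpow_sum_of_pos (by positivity),
    ← Real.rpow_intCast, ← Real.rpow_mul (by norm_num)]
  rfl

theorem map_dyadicDilation_volume (k : ℤ) :
    Measure.map (M.dyadicDilation k) volume =
      (2 : ℝ≥0∞) ^ (-(k * M.total)) • (volume : Measure (EuclideanSpace ℝ (Fin n))) := by
  have h := Measure.map_linearMap_addHaar_eq_smul_addHaar
    (volume : Measure (EuclideanSpace ℝ (Fin n)))
    (f := (M.dyadicDilation k : EuclideanSpace ℝ (Fin n) →ₗ[ℝ] EuclideanSpace ℝ (Fin n)))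
    (by rw [det_dyadicDilation]; positivity)
  rw [det_dyadicDilation, ← Real.rpow_neg (by norm_num), abs_of_pos (by positivity),
    ← ENNReal.ofReal_rpow_of_pos (by norm_num)] at h
  simpa using h

theorem measurableEmbedding_dyadicDilation (k : ℤ) :
    MeasurableEmbedding (M.dyadicDilation k) :=
  (M.dyadicDilation k).toHomeomorph.measurableEmbedding

/-- The change of variables contributes the determinant to the power `-1/p`. Writing `1/p` as
`(p⁻¹).toReal` includes `p = ∞`, where the exponent is 0. -/
theorem eLpNorm_comp_dyadicDilation {F : Type*} [TopologicalSpace F] [ContinuousENorm F]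
    (k : ℤ) (p : ℝ≥0∞) (f : EuclideanSpace ℝ (Fin n) → F) :
    eLpNorm (fun x => f (M.dyadicDilation k x)) p volume =
      (2 : ℝ≥0∞) ^ (-(k * M.total * (p⁻¹).toReal)) * eLpNorm f p volume := by
  have h := (M.measurableEmbedding_dyadicDilation k).eLpNorm_map_measure
    (g := f) (p := p) (μ := volume)
  rw [map_dyadicDilation_volume, eLpNorm_smul_measure_of_ne_zero (by simp)] at h
  rw [show (fun x => f (M.dyadicDilation k x)) = f ∘ M.dyadicDilation k from rfl, ← h,
    ← ENNReal.rpow_mul, one_div, smul_eq_mul, neg_mul]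

theorem integral_comp_dyadicDilation (k : ℤ) (f : EuclideanSpace ℝ (Fin n) → ℂ) :
    ∫ x, f (M.dyadicDilation k x) = ((2 : ℝ) ^ (-(k * M.total)) : ℝ) * ∫ x, f x := by
  have h := (M.measurableEmbedding_dyadicDilation k).integral_map (μ := volume) f
  rw [← h, map_dyadicDilation_volume, integral_smul_measure, ← ENNReal.toReal_rpow]
  simp

end AnisotropicWeight

/-! ### Sequence quasi-norms -/

theorem le_ellNorm {q : ℝ≥0∞} (hq : 0 < q) (a : ℕ → ℝ≥0∞) (j : ℕ) : a j ≤ ellNorm q a := by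
  unfold ellNorm
  split_ifs with h
  · exact le_iSup a j
  · have hq' : 0 < q.toReal := ENNReal.toReal_pos hq.ne' h
    calc a j = (a j ^ q.toReal) ^ (1 / q.toReal) := by
          rw [← ENNReal.rpow_mul, mul_one_div_cancel hq'.ne', ENNReal.rpow_one]
      _ ≤ _ := ENNReal.rpow_le_rpow (ENNReal.le_tsum j) (by positivity)

theorem ellNorm_mono {q : ℝ≥0∞} {a b : ℕ → ℝ≥0∞} (h : ∀ j, a j ≤ b j) :
    ellNorm q a ≤ ellNorm q b := by
  unfold ellNorm
  split_ifs with hq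
  · exact iSup_mono h
  · exact ENNReal.rpow_le_rpow (ENNReal.tsum_le_tsum fun j =>
      ENNReal.rpow_le_rpow (h j) ENNReal.toReal_nonneg) (by positivity)

/-- This power `N^{1/q}` is the source of the sum exponents in the borderline conditions.
Nonemptiness is needed for `q = ∞`, where the power of the cardinality is 1 even for empty `J`. -/
theorem ellNorm_ite_const {q : ℝ≥0∞} (hq : 0 < q) {J : Finset ℕ} (hJ : J.Nonempty) (b : ℝ≥0∞) :
    ellNorm q (fun j => if j ∈ J then b else 0) = (J.card : ℝ≥0∞) ^ (q⁻¹).toReal * b := by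
  unfold ellNorm
  split_ifs with h
  · obtain ⟨i, hi⟩ := hJ
    simp only [h, ENNReal.inv_top, ENNReal.toReal_zero, ENNReal.rpow_zero, one_mul]
    refine le_antisymm (iSup_le fun j => by split_ifs <;> simp) ?_
    exact (by simp [hi] : b ≤ if i ∈ J then b else 0).trans
      (le_iSup (fun j => if j ∈ J then b else 0) i)
  · have hq' : 0 < q.toReal := ENNReal.toReal_pos hq.ne' h
    rw [tsum_eq_sum (s := J) (fun j hj => by simp [hj, hq'])]
    rw [Finset.sum_congr rfl (g := fun _ => b ^ q.toReal) (fun j hj => by simp [hj]),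
      Finset.sum_const, nsmul_eq_mul, ENNReal.mul_rpow_of_nonneg _ _ (by positivity),
      ← ENNReal.rpow_mul, mul_one_div_cancel hq'.ne', ENNReal.rpow_one, ENNReal.toReal_inv, one_div]

/-- If `C₁ tᵃ ≤ C₂ tᵇ` as `t → ∞`, then `a ≤ b`. -/
theorem exponent_le_of_tendsto_top {t : ℕ → ℝ≥0∞} (ht : Tendsto t atTop (𝓝 ⊤))
    (htop : ∀ N, t N ≠ ⊤) {c₁ c₂ : ℝ≥0∞} (h₁ : c₁ ≠ 0) (h₂ : c₂ ≠ ⊤) {a b : ℝ}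
    (h : ∀ᶠ N in atTop, c₁ * t N ^ a ≤ c₂ * t N ^ b) : a ≤ b := by
  by_contra! hab
  have h3 : Tendsto (fun N => c₁ * t N ^ (a - b)) atTop (𝓝 ⊤) := by
    have h4 : Tendsto (fun N => t N ^ (a - b)) atTop (𝓝 ⊤) := by
      have := ((ENNReal.continuous_rpow_const (y := a - b)).tendsto ⊤).comp ht
      rwa [ENNReal.top_rpow_of_pos (by linarith)] at this
    have := ENNReal.Tendsto.const_mul h4 (a := c₁) (Or.inl (by simp))
    rwa [ENNReal.mul_top h₁] at this
  have h5 : ∀ᶠ N in atTop, c₁ * t N ^ (a - b) ≤ c₂ := by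
    have hpos : ∀ᶠ N in atTop, 0 < t N := ht.eventually_const_lt (by simp)
    filter_upwards [h, hpos] with N hN hN0
    rw [sub_eq_add_neg, ENNReal.rpow_add _ _ hN0.ne' (htop N), ← mul_assoc]
    calc c₁ * t N ^ a * t N ^ (-b) ≤ c₂ * t N ^ b * t N ^ (-b) := by gcongr
      _ = c₂ := by
        rw [mul_assoc, ← ENNReal.rpow_add _ _ hN0.ne' (htop N), add_neg_cancel,
          ENNReal.rpow_zero, mul_one]
  exact h₂ (top_le_iff.mp (le_of_tendsto h3 h5))

theorem tendsto_natCast_ennreal : Tendsto (fun N : ℕ => (N : ℝ≥0∞)) atTop (𝓝 ⊤) :=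
  ENNReal.tendsto_nat_nhds_top

theorem tendsto_two_pow_ennreal : Tendsto (fun N : ℕ => (2 : ℝ≥0∞) ^ N) atTop (𝓝 ⊤) :=
  ENNReal.tendsto_pow_atTop_nhds_top_iff.mpr (by norm_num)

end

noncomputable section

/-! ### Frequency sets on which the dyadic partition is trivial -/

namespace AnisotropicWeight

variable {n : ℕ} (M : AnisotropicWeight n)

/-- The frequencies that only `Φ_k` sees. -/
def core (k : ℕ) : Set (EuclideanSpace ℝ (Fin n)) :=
  {ξ | M.size ξ ≤ 11 / 10 * 2 ^ k ∧ (k ≠ 0 → 13 / 20 * 2 ^ k ≤ M.size ξ)}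

/-- The bound `[ξ] ≤ (11/10)2^k` makes `Ψ_i = 1` for all `i ≥ k`, and `[ξ] ≥ (13/20)2^k =
(13/10)2^{k-1}` makes `Ψ_i = 0` for all `i < k`. For `k = 0` no lower bound is needed because
`Ψ_{-1} = 0` by definition. -/
theorem dyadic_of_mem_core (Ψ : DyadicCutoff) {k : ℕ} {ξ : EuclideanSpace ℝ (Fin n)}
    (hξ : ξ ∈ M.core k) (j : ℕ) : Ψ.dyadic M j ξ = if j = k then 1 else 0 := by
  obtain ⟨h1, h2⟩ := hξ
  have h0 := M.size_nonneg ξ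
  have one : ∀ i : ℤ, 0 ≤ i → (k : ℤ) ≤ i → Ψ.low M i ξ = 1 := by
    intro i hi hki
    rw [DyadicCutoff.low, if_pos hi]
    refine Ψ.eq_one _ (by positivity) ?_
    rw [zpow_neg, inv_mul_le_iff₀ (by positivity)]
    have : (2 : ℝ) ^ k ≤ 2 ^ i := by
      rw [← zpow_natCast]; exact zpow_le_zpow_right₀ (by norm_num) hki
    linarith
  have zero : ∀ i : ℤ, i < k → Ψ.low M i ξ = 0 := by
    intro i hki
    rw [DyadicCutoff.low]
    split_ifs with hi
    · refine Ψ.eq_zero _ ?_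
      rw [zpow_neg, le_inv_mul_iff₀ (by positivity)]
      have h3 : (2 : ℝ) * 2 ^ i ≤ 2 ^ k := by
        rw [← zpow_natCast, ← zpow_one_add₀ (by norm_num)]
        exact zpow_le_zpow_right₀ (by norm_num) (by omega)
      have := h2 (by omega)
      linarith
    · rfl
  rw [DyadicCutoff.dyadic]
  rcases lt_trichotomy j k with h | h | h
  · rw [zero _ (by omega), zero _ (by omega), if_neg (by omega), sub_zero]
  · rw [one _ (by omega) (by omega), zero _ (by omega), if_pos h, sub_zero]
  · rw [one _ (by omega) (by omega), one _ (by omega) (by omega), if_neg (by omega), sub_self]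

/-- A unit vector in a direction of weight one. -/
def unitVector : EuclideanSpace ℝ (Fin n) :=
  EuclideanSpace.single M.exists_eq_one.choose 1

theorem norm_unitVector : ‖M.unitVector‖ = 1 := by
  simp [unitVector]

theorem size_unitVector : M.size M.unitVector = 1 := by
  refine M.size_eq one_pos ?_
  simp [unitVector, PiLp.single_apply, ite_pow]

/-- The direction was chosen with weight one precisely so that anisotropic dilation acts on it as
ordinary scaling. -/
theorem dyadicDilation_unitVector (k : ℤ) :
    M.dyadicDilation k M.unitVector = (2 : ℝ) ^ k • M.unitVector := by
  ext j
  rw [dyadicDilation_apply, PiLp.smul_apply, smul_eq_mul, unitVector, PiLp.single_apply]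
  split_ifs with h
  · rw [h, M.exists_eq_one.choose_spec, Real.rpow_one]
  · simp

/-- The set `2^{kM}(σe + B_r)`. -/
def patch (σ : ℝ) (k : ℤ) (r : ℝ) : Set (EuclideanSpace ℝ (Fin n)) :=
  {ξ | ∃ y, ‖y‖ ≤ r ∧ ξ = M.dyadicDilation k (σ • M.unitVector + y)}

/-- Continuity of `[·]` at `e`, where it equals 1. The tolerance `1/20` puts the values in `[19/20,
21/20]`, inside the interval `[13/20, 11/10]` that defines a core. -/
theorem exists_radius : ∃ r : ℝ, 0 < r ∧ r < 1 ∧ ∀ y, ‖y‖ ≤ r →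
    |M.size (M.unitVector + y) - 1| ≤ 1 / 20 := by
  have he : M.unitVector ≠ 0 := by
    rw [← norm_pos_iff, norm_unitVector]; exact one_pos
  have hc := (M.contDiffAt_size he).continuousAt
  obtain ⟨δ, hδ, h⟩ := Metric.continuousAt_iff.mp hc (1 / 20) (by norm_num)
  refine ⟨min (δ / 2) (1 / 2), by positivity, by
    have := min_le_right (δ / 2) (1 / 2 : ℝ); linarith, fun y hy => ?_⟩
  have h1 := h (x := M.unitVector + y) (by
    rw [dist_eq_norm, add_sub_cancel_left]
    have := min_le_left (δ / 2) (1 / 2 : ℝ); linarith)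
  rw [size_unitVector, Real.dist_eq] at h1
  exact h1.le

/-- A radius for which all patches used below lie in the cores. -/
def radius : ℝ := M.exists_radius.choose / 3

theorem radius_pos : 0 < M.radius := by
  have := M.exists_radius.choose_spec.1
  unfold radius; positivity

theorem radius_lt : 3 * M.radius < 1 := by
  have := M.exists_radius.choose_spec.2.1
  unfold radius; linarith

/-- The factor 3 leaves room for products: multiplying two functions with patches of size `radius`
at most doubles the patch. -/
theorem size_unitVector_add {y : EuclideanSpace ℝ (Fin n)} (hy : ‖y‖ ≤ 3 * M.radius) :
    |M.size (M.unitVector + y) - 1| ≤ 1 / 20 :=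
  M.exists_radius.choose_spec.2.2 y (by unfold radius at hy; linarith)

theorem patch_mono {σ : ℝ} {k : ℤ} {r r' : ℝ} (h : r ≤ r') : M.patch σ k r ⊆ M.patch σ k r' :=
  fun _ ⟨y, hy, hξ⟩ => ⟨y, hy.trans h, hξ⟩

theorem patch_subset_core {σ : ℝ} (hσ : |σ| = 1) (k : ℕ) :
    M.patch σ k (3 * M.radius) ⊆ M.core k := by
  rintro _ ⟨y, hy, rfl⟩
  have key : |M.size (σ • M.unitVector + y) - 1| ≤ 1 / 20 := by
    rcases eq_or_eq_neg_of_abs_eq hσ with rfl | rfl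
    · rw [one_smul]; exact M.size_unitVector_add hy
    · rw [← M.size_neg, neg_add, neg_smul, neg_neg, one_smul]
      exact M.size_unitVector_add (by rwa [norm_neg])
  rw [abs_le] at key
  have h2 : (0 : ℝ) < 2 ^ k := by positivity
  rw [core, Set.mem_ofPred_eq, size_dyadicDilation, zpow_natCast]
  exact ⟨by nlinarith, fun _ => by nlinarith⟩

/-- Negative `k` is included so that functions spread out by `2^{-kM}` are covered; they all stay in
band 0. -/
theorem patch_zero_subset_core {k : ℤ} (hk : k ≤ 0) :
    M.patch 0 k (3 * M.radius) ⊆ M.core 0 := by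
  rintro _ ⟨y, hy, rfl⟩
  have h1 := M.norm_dyadicDilation_le hk y
  have h2 : (2 : ℝ) ^ k ≤ 1 := zpow_le_one_of_nonpos₀ (by norm_num) hk
  have h3 : (0 : ℝ) < 2 ^ k := by positivity
  have h4 := M.radius_lt
  rw [zero_smul, zero_add]
  refine ⟨?_, fun h => absurd rfl h⟩
  have h6 := norm_nonneg y
  have h5 : M.size (M.dyadicDilation k y) ≤ 1 := M.size_le_one (by nlinarith)
  norm_num
  linarith

/-- Since `2e = 2^M e`, doubling the frequency moves exactly one dyadic step up, and the error
vector only shrinks. Squares of blocks at level `k` thus land in band `k + 1`. -/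
theorem patch_two_subset (k : ℤ) {r : ℝ} : M.patch 2 k r ⊆ M.patch 1 (k + 1) r := by
  rintro _ ⟨y, hy, rfl⟩
  refine ⟨M.dyadicDilation (-1) y, (M.norm_dyadicDilation_le (by norm_num) y).trans ?_, ?_⟩
  · have := norm_nonneg y
    norm_num
    linarith
  · rw [dyadicDilation_add, map_add (M.dyadicDilation 1), M.dyadicDilation_cancel_neg 1, one_smul,
      dyadicDilation_unitVector, zpow_one]

open Pointwise in
theorem patch_add_same {σ τ : ℝ} {k : ℤ} {r r' : ℝ} :
    M.patch σ k r + M.patch τ k r' ⊆ M.patch (σ + τ) k (r + r') := by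
  rintro _ ⟨_, ⟨y, hy, rfl⟩, _, ⟨z, hz, rfl⟩, rfl⟩
  refine ⟨y + z, (norm_add_le _ _).trans (add_le_add hy hz), ?_⟩
  simp only [map_add, map_smul, add_smul]
  abel

open Pointwise in
theorem patch_add_low {σ : ℝ} {k : ℤ} (hk : 0 ≤ k) {r r' : ℝ} :
    M.patch σ k r + M.patch 0 0 r' ⊆ M.patch σ k (r + r') := by
  rintro _ ⟨_, ⟨y, hy, rfl⟩, _, ⟨z, hz, rfl⟩, rfl⟩
  have hz' : ‖M.dyadicDilation (-k) z‖ ≤ r' := by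
    refine (M.norm_dyadicDilation_le (by omega) z).trans (le_trans ?_ hz)
    exact mul_le_of_le_one_left (norm_nonneg z)
      (zpow_le_one_of_nonpos₀ (by norm_num) (by omega))
  refine ⟨y + M.dyadicDilation (-k) z, (norm_add_le _ _).trans (add_le_add hy hz'), ?_⟩
  simp only [map_add, M.dyadicDilation_cancel_neg, zero_smul, dyadicDilation_zero, zero_add]
  rw [add_assoc]

open Pointwise in
-- Seen from scale `k`, the lower patch consists of vectors of norm at most `2 · 2^{-L} ≤ radius`,
-- where 2 bounds `|τ| + radius`. Adding it therefore only enlarges the upper patch a little.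
theorem patch_add_far {σ τ : ℝ} (hτ : |τ| ≤ 1) {k l : ℤ} {L : ℕ} (hL : 2 ≤ M.radius * 2 ^ L)
    (hkl : l + L ≤ k) :
    M.patch σ k M.radius + M.patch τ l M.radius ⊆ M.patch σ k (3 * M.radius) := by
  rintro _ ⟨_, ⟨y, hy, rfl⟩, _, ⟨z, hz, rfl⟩, rfl⟩
  have h1 : ‖τ • M.unitVector + z‖ ≤ 2 := by
    refine (norm_add_le _ _).trans ?_
    rw [norm_smul, norm_unitVector, mul_one, Real.norm_eq_abs]
    linarith [M.radius_lt, M.radius_pos]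
  have hz' : ‖M.dyadicDilation (l - k) (τ • M.unitVector + z)‖ ≤ M.radius := by
    refine (M.norm_dyadicDilation_le (by omega) _).trans ?_
    have h2 : (2 : ℝ) ^ (l - k) ≤ ((2 : ℝ) ^ L)⁻¹ := by
      rw [← zpow_natCast, ← zpow_neg]
      exact zpow_le_zpow_right₀ (by norm_num) (by omega)
    calc (2 : ℝ) ^ (l - k) * ‖τ • M.unitVector + z‖ ≤ ((2 : ℝ) ^ L)⁻¹ * 2 := by gcongr
      _ ≤ M.radius := by rw [inv_mul_le_iff₀ (by positivity)]; linarith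
  refine ⟨y + M.dyadicDilation (l - k) (τ • M.unitVector + z),
    (norm_add_le _ _).trans (by linarith [M.radius_pos]), ?_⟩
  simp only [← add_assoc]
  rw [map_add _ (σ • M.unitVector + y), ← dyadicDilation_add, add_sub_cancel]

/-- A gap for which products of pieces with distinct frequencies stay in a core. -/
theorem exists_gap : ∃ L : ℕ, 2 ≤ L ∧ 2 ≤ M.radius * 2 ^ L := by
  obtain ⟨L, hL⟩ := pow_unbounded_of_one_lt (2 / M.radius) (one_lt_two (α := ℝ))
  -- The extra 2 forces a gap of at least two, so that `k + 1` never belongs to a sparse set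
  -- containing `k`; squares of blocks then occupy free bands.
  refine ⟨L + 2, by omega, ?_⟩
  rw [div_lt_iff₀ M.radius_pos] at hL
  rw [pow_add]
  have := M.radius_pos
  nlinarith [show (0 : ℝ) < 2 ^ L by positivity]

end AnisotropicWeight

/-! ### Lacunary sets of frequencies -/

/-- Any two distinct elements of `J` differ by at least `L`. -/
def Sparse (L : ℕ) (J : Finset ℕ) : Prop :=
  ∀ k ∈ J, ∀ l ∈ J, k ≠ l → k + L ≤ l ∨ l + L ≤ k

/-- An arithmetic progression with step `L` starting at `K`. A positive `K` keeps band 0 free for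
the diagonal of a product; a larger `K` reaches the range where asymptotic lower bounds hold. -/
theorem exists_sparse (L : ℕ) (hL : L ≠ 0) (K N : ℕ) :
    ∃ J : Finset ℕ, J.card = N ∧ Sparse L J ∧ ∀ k ∈ J, K ≤ k := by
  have hinj : Function.Injective fun i : ℕ => K + L * i := fun a b h => by
    simpa [hL] using h
  refine ⟨(Finset.range N).image fun i => K + L * i, ?_, ?_, ?_⟩
  · rw [Finset.card_image_of_injective _ hinj, Finset.card_range]
  · intro k hk l hl hkl
    obtain ⟨i, -, rfl⟩ := Finset.mem_image.mp hk
    obtain ⟨j, -, rfl⟩ := Finset.mem_image.mp hl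
    rcases lt_trichotomy i j with h | h | h
    · left
      have := Nat.mul_le_mul_left L (show i + 1 ≤ j from h)
      linarith
    · exact absurd (by rw [h]) hkl
    · right
      have := Nat.mul_le_mul_left L (show j + 1 ≤ i from h)
      linarith
  · intro k hk
    obtain ⟨i, -, rfl⟩ := Finset.mem_image.mp hk
    simp

end

noncomputable section

/-! ### The spectrum of a Schwartz function -/

section Spectrum

variable {n : ℕ}

/-- The Fourier transform `f̂(ξ) = ∫ e^{-i x·ξ} f(x) dx` vanishes outside `S`. -/
def SpectrumIn (f : 𝓢(EuclideanSpace ℝ (Fin n), ℂ)) (S : Set (EuclideanSpace ℝ (Fin n))) : Prop :=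
  ∀ η, 𝓕 f η ≠ 0 → (2 * Real.pi) • η ∈ S

theorem SpectrumIn.mono {f : 𝓢(EuclideanSpace ℝ (Fin n), ℂ)} {S T : Set (EuclideanSpace ℝ (Fin n))}
    (h : SpectrumIn f S) (hST : S ⊆ T) : SpectrumIn f T := fun η hη => hST (h η hη)

theorem SpectrumIn.const_smul {f : 𝓢(EuclideanSpace ℝ (Fin n), ℂ)}
    {S : Set (EuclideanSpace ℝ (Fin n))} (h : SpectrumIn f S) (c : ℂ) : SpectrumIn (c • f) S := by
  intro η hη
  refine h η fun h0 => hη ?_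
  rw [FourierTransform.fourier_smul, _root_.smul_apply, h0, smul_zero]

theorem bandPart_coe (χ f : 𝓢(EuclideanSpace ℝ (Fin n), ℂ)) (x : EuclideanSpace ℝ (Fin n)) :
    bandPart χ f x = ∫ η, Complex.exp (2 * Real.pi * Complex.I * (inner ℝ x η : ℝ)) *
      χ ((2 * Real.pi) • η) * 𝓕 f η := by
  rw [bandPart, TemperedDistribution.fourier_toTemperedDistributionCLM_eq, SchwartzMap.coe_apply]
  simp only [waveTest_apply, smul_eq_mul]

theorem eq_integral_fourier (f : 𝓢(EuclideanSpace ℝ (Fin n), ℂ)) (x : EuclideanSpace ℝ (Fin n)) :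
    f x = ∫ η, Complex.exp (2 * Real.pi * Complex.I * (inner ℝ x η : ℝ)) * 𝓕 f η := by
  have h : f x = 𝓕⁻ (𝓕 f) x := by rw [FourierTransform.fourierInv_fourier_eq]
  rw [h, SchwartzMap.fourierInv_coe, Real.fourierInv_eq']
  refine integral_congr_ae (Eventually.of_forall fun η => ?_)
  simp only [smul_eq_mul, real_inner_comm x η]
  congr 2
  push_cast
  ring

theorem bandPart_eq_self {χ f : 𝓢(EuclideanSpace ℝ (Fin n), ℂ)}
    {S : Set (EuclideanSpace ℝ (Fin n))} (hf : SpectrumIn f S) (hχ : ∀ ξ ∈ S, χ ξ = 1) :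
    bandPart χ f = f := by
  ext x
  rw [bandPart_coe, eq_integral_fourier f x]
  refine integral_congr_ae (Eventually.of_forall fun η => ?_)
  by_cases h : 𝓕 f η = 0
  · simp [h]
  · simp only [hχ _ (hf η h), mul_one]

theorem bandPart_eq_zero {χ f : 𝓢(EuclideanSpace ℝ (Fin n), ℂ)}
    {S : Set (EuclideanSpace ℝ (Fin n))} (hf : SpectrumIn f S) (hχ : ∀ ξ ∈ S, χ ξ = 0) :
    bandPart χ f = 0 := by
  ext x
  rw [bandPart_coe, Pi.zero_apply, ← integral_zero (EuclideanSpace ℝ (Fin n)) ℂ]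
  refine integral_congr_ae (Eventually.of_forall fun η => ?_)
  by_cases h : 𝓕 f η = 0
  · simp [h]
  · simp only [hχ _ (hf η h), mul_zero, zero_mul]

theorem bandPart_sum {ι : Type*} (χ : 𝓢(EuclideanSpace ℝ (Fin n), ℂ))
    (f : ι → 𝓢(EuclideanSpace ℝ (Fin n), ℂ)) (J : Finset ι) (x : EuclideanSpace ℝ (Fin n)) :
    bandPart χ (∑ i ∈ J, f i : 𝓢(EuclideanSpace ℝ (Fin n), ℂ)) x =
      ∑ i ∈ J, bandPart χ (f i) x := by
  simp only [bandPart, TemperedDistribution.fourier_toTemperedDistributionCLM_eq, FourierTransform.fourier_sum,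
    map_sum, _root_.sum_apply]

theorem bandPart_smul (χ f : 𝓢(EuclideanSpace ℝ (Fin n), ℂ)) (c : ℂ)
    (x : EuclideanSpace ℝ (Fin n)) :
    bandPart χ (c • f : 𝓢(EuclideanSpace ℝ (Fin n), ℂ)) x = c * bandPart χ f x := by
  simp only [bandPart, TemperedDistribution.fourier_toTemperedDistributionCLM_eq,
    FourierTransform.fourier_smul, map_smul, _root_.smul_apply, smul_eq_mul]

/-- Multiplication by `e^{i x·ξ}`. -/
def waveMul (ξ : EuclideanSpace ℝ (Fin n)) (f : 𝓢(EuclideanSpace ℝ (Fin n), ℂ)) :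
    𝓢(EuclideanSpace ℝ (Fin n), ℂ) :=
  SchwartzMap.smulLeftCLM ℂ (fun x => Complex.exp (2 * Real.pi * Complex.I *
    (inner ℝ ((2 * Real.pi)⁻¹ • ξ) x : ℝ))) f

theorem waveMul_apply (ξ x : EuclideanSpace ℝ (Fin n)) (f : 𝓢(EuclideanSpace ℝ (Fin n), ℂ)) :
    waveMul ξ f x = Complex.exp ((inner ℝ ξ x : ℝ) * Complex.I) * f x := by
  rw [waveMul, SchwartzMap.smulLeftCLM_apply_apply (planeWave_hasTemperateGrowth _), smul_eq_mul,
    inner_smul_left]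
  congr 2
  have := Complex.ofReal_ne_zero.mpr Real.pi_pos.ne'
  push_cast
  simp
  field_simp

theorem norm_waveMul_apply (ξ x : EuclideanSpace ℝ (Fin n)) (f : 𝓢(EuclideanSpace ℝ (Fin n), ℂ)) :
    ‖waveMul ξ f x‖ = ‖f x‖ := by
  rw [waveMul_apply, norm_mul, Complex.norm_exp_ofReal_mul_I, one_mul]

theorem enorm_waveMul_apply (ξ x : EuclideanSpace ℝ (Fin n))
    (f : 𝓢(EuclideanSpace ℝ (Fin n), ℂ)) : ‖waveMul ξ f x‖ₑ = ‖f x‖ₑ := by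
  rw [← ofReal_norm, norm_waveMul_apply, ofReal_norm]

theorem waveMul_zero (f : 𝓢(EuclideanSpace ℝ (Fin n), ℂ)) : waveMul 0 f = f := by
  ext x
  simp [waveMul_apply]

theorem schwartzMul_waveMul (ξ ζ : EuclideanSpace ℝ (Fin n))
    (f g : 𝓢(EuclideanSpace ℝ (Fin n), ℂ)) :
    schwartzMul (waveMul ξ f) (waveMul ζ g) = waveMul (ξ + ζ) (schwartzMul f g) := by
  ext x
  simp only [schwartzMul_apply, waveMul_apply, inner_add_left, Complex.ofReal_add, add_mul,
    Complex.exp_add]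
  ring

theorem fourier_waveMul (ξ η : EuclideanSpace ℝ (Fin n)) (f : 𝓢(EuclideanSpace ℝ (Fin n), ℂ)) :
    𝓕 (waveMul ξ f) η = 𝓕 f (η - (2 * Real.pi)⁻¹ • ξ) := by
  rw [SchwartzMap.fourier_coe, SchwartzMap.fourier_coe, Real.fourier_eq', Real.fourier_eq']
  refine integral_congr_ae (Eventually.of_forall fun x => ?_)
  simp only [smul_eq_mul, waveMul_apply]
  rw [← mul_assoc, ← Complex.exp_add, inner_sub_right, inner_smul_right, real_inner_comm x ξ]
  congr 2
  have := Complex.ofReal_ne_zero.mpr Real.pi_pos.ne'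
  push_cast
  field_simp
  ring

theorem SpectrumIn.waveMul {f : 𝓢(EuclideanSpace ℝ (Fin n), ℂ)}
    {S T : Set (EuclideanSpace ℝ (Fin n))} (hf : SpectrumIn f S) (ξ : EuclideanSpace ℝ (Fin n))
    (hT : ∀ ζ ∈ S, ξ + ζ ∈ T) : SpectrumIn (waveMul ξ f) T := by
  intro η hη
  rw [fourier_waveMul] at hη
  have := hT _ (hf _ hη)
  rwa [smul_sub, smul_smul, mul_inv_cancel₀ Real.two_pi_pos.ne', one_smul,
    add_sub_cancel] at this

open Pointwise in
theorem SpectrumIn.schwartzMul {f g : 𝓢(EuclideanSpace ℝ (Fin n), ℂ)}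
    {S T : Set (EuclideanSpace ℝ (Fin n))} (hf : SpectrumIn f S) (hg : SpectrumIn g T) :
    SpectrumIn (schwartzMul f g) (S + T) := by
  intro ζ hζ
  -- The convolution formula, obtained by moving the Fourier transform across the integral of `𝓕 (𝓕⁻
  -- f)` against `g` modulated to frequency `-ζ`. If the integral is nonzero, some `-η` and `η + ζ`
  -- lie in the two spectra, and they add up to `ζ`.
  have h1 : 𝓕 (_root_.schwartzMul f g) ζ = ∫ η, 𝓕 f (-η) * 𝓕 g (η + ζ) := by
    have h2 := SchwartzMap.integral_fourier_mul_eq (𝓕⁻ f) (_root_.waveMul (-((2 * Real.pi) • ζ)) g)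
    rw [FourierTransform.fourier_fourierInv_eq] at h2
    have h3 : ∀ η, (𝓕⁻ f) η = 𝓕 f (-η) := fun η => by
      rw [SchwartzMap.fourierInv_coe, SchwartzMap.fourier_coe, Real.fourierInv_eq_fourier_neg]
    simp only [fourier_waveMul, h3, smul_neg, smul_smul, inv_mul_cancel₀ Real.two_pi_pos.ne',
      one_smul, sub_neg_eq_add] at h2
    rw [← h2, SchwartzMap.fourier_coe, Real.fourier_eq']
    refine integral_congr_ae (Eventually.of_forall fun x => ?_)
    simp only [smul_eq_mul, waveMul_apply, schwartzMul_apply, inner_neg_left, inner_smul_left]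
    rw [mul_left_comm, real_inner_comm x ζ]
    congr 3
    push_cast
    simp
  rw [h1] at hζ
  obtain ⟨η, hη⟩ : ∃ η, 𝓕 f (-η) * 𝓕 g (η + ζ) ≠ 0 := by
    by_contra! h
    exact hζ (by simp [h])
  obtain ⟨ha, hb⟩ := mul_ne_zero_iff.mp hη
  refine ⟨_, hf _ ha, _, hg _ hb, ?_⟩
  simp only [← smul_add]
  congr 1
  abel

/-- `f(2^{kM} x)`. -/
def dilate (M : AnisotropicWeight n) (k : ℤ) (f : 𝓢(EuclideanSpace ℝ (Fin n), ℂ)) :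
    𝓢(EuclideanSpace ℝ (Fin n), ℂ) :=
  SchwartzMap.compCLMOfContinuousLinearEquiv ℂ (M.dyadicDilation k) f

variable (M : AnisotropicWeight n)

theorem dilate_apply (k : ℤ) (f : 𝓢(EuclideanSpace ℝ (Fin n), ℂ)) (x : EuclideanSpace ℝ (Fin n)) :
    dilate M k f x = f (M.dyadicDilation k x) := rfl

theorem schwartzMul_dilate (k : ℤ) (f g : 𝓢(EuclideanSpace ℝ (Fin n), ℂ)) :
    schwartzMul (dilate M k f) (dilate M k g) = dilate M k (schwartzMul f g) := rfl

theorem fourier_dilate (k : ℤ) (f : 𝓢(EuclideanSpace ℝ (Fin n), ℂ))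
    (η : EuclideanSpace ℝ (Fin n)) :
    𝓕 (dilate M k f) η =
      ((2 : ℝ) ^ (-(k * M.total)) : ℝ) * 𝓕 f (M.dyadicDilation (-k) η) := by
  rw [SchwartzMap.fourier_coe, SchwartzMap.fourier_coe, Real.fourier_eq', Real.fourier_eq',
    ← M.integral_comp_dyadicDilation]
  refine integral_congr_ae (Eventually.of_forall fun x => ?_)
  simp only [dilate_apply]
  rw [M.inner_dyadicDilation, M.dyadicDilation_cancel_neg]

theorem SpectrumIn.dilate {f : 𝓢(EuclideanSpace ℝ (Fin n), ℂ)}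
    {S T : Set (EuclideanSpace ℝ (Fin n))} (hf : SpectrumIn f S) (k : ℤ)
    (hT : ∀ ζ ∈ S, M.dyadicDilation k ζ ∈ T) : SpectrumIn (dilate M k f) T := by
  intro η hη
  rw [fourier_dilate] at hη
  have := hT _ (hf _ (right_ne_zero_of_mul hη))
  rwa [map_smul, M.dyadicDilation_cancel_neg] at this

end Spectrum

end

noncomputable section

/-! ### Quasi-norms of functions with spectrum in the cores -/

theorem two_rpow_mul (a b : ℝ) : (2 : ℝ≥0∞) ^ a * 2 ^ b = 2 ^ (a + b) :=
  (ENNReal.rpow_add _ _ (by norm_num) (by norm_num)).symm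

theorem two_rpow_ne_top (a : ℝ) : (2 : ℝ≥0∞) ^ a ≠ ⊤ :=
  ENNReal.rpow_ne_top_of_ne_zero (by norm_num) (by norm_num)

theorem two_rpow_ne_zero (a : ℝ) : (2 : ℝ≥0∞) ^ a ≠ 0 := by
  simp

theorem eLpNorm_const_mul_enorm {α F : Type*} [MeasurableSpace α] [NormedAddCommGroup F]
    [NormedSpace ℝ F] {c : ℝ≥0∞} (hc : c ≠ ⊤) (f : α → F) (p : ℝ≥0∞) (μ : Measure α) :
    eLpNorm (fun x => c * ‖f x‖ₑ) p μ = c * eLpNorm f p μ := by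
  have h : ‖c.toReal‖ₑ = c := by
    rw [Real.enorm_of_nonneg ENNReal.toReal_nonneg, ENNReal.ofReal_toReal hc]
  have h2 := eLpNorm_const_smul c.toReal f p μ
  rw [h] at h2
  rw [← h2]
  refine eLpNorm_congr_enorm_ae (Eventually.of_forall fun x => ?_)
  rw [enorm_eq_self, Pi.smul_apply, enorm_smul, h]

section Norms

variable {n : ℕ} (M : AnisotropicWeight n) (Ψ : DyadicCutoff)

theorem SpaceParams.recip_eq (A : SpaceParams) : A.recip = (A.p⁻¹).toReal := rfl

theorem spaceNorm_of_besov {A : SpaceParams} (hA : A.scale = Scale.B)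
    (u : 𝓢'(EuclideanSpace ℝ (Fin n), ℂ)) :
    spaceNorm M Ψ A u = ellNorm A.q fun j =>
      (2 : ℝ≥0∞) ^ (A.s * j) * eLpNorm (bandPart (Ψ.dyadicSchwartz M j) u) A.p volume := by
  simp only [spaceNorm, hA]

theorem spaceNorm_of_triebel {A : SpaceParams} (hA : A.scale = Scale.F)
    (u : 𝓢'(EuclideanSpace ℝ (Fin n), ℂ)) :
    spaceNorm M Ψ A u = eLpNorm (fun x => ellNorm A.q fun j =>
      (2 : ℝ≥0∞) ^ (A.s * j) * ‖bandPart (Ψ.dyadicSchwartz M j) u x‖ₑ) A.p volume := by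
  simp only [spaceNorm, hA]

/-- A single band is dominated by the full quasi-norm in either scale. This bounds the target norm
of a product from below through band 0 alone, without knowing the scale of `A₂`. -/
theorem le_spaceNorm (A : SpaceParams) (u : 𝓢'(EuclideanSpace ℝ (Fin n), ℂ)) (j : ℕ) :
    (2 : ℝ≥0∞) ^ (A.s * j) * eLpNorm (bandPart (Ψ.dyadicSchwartz M j) u) A.p volume ≤
      spaceNorm M Ψ A u := by
  cases hA : A.scale
  · rw [spaceNorm_of_besov M Ψ hA]
    exact le_ellNorm A.q_pos (fun j : ℕ => (2 : ℝ≥0∞) ^ (A.s * j) *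
      eLpNorm (bandPart (Ψ.dyadicSchwartz M j) u) A.p volume) j
  · rw [spaceNorm_of_triebel M Ψ hA, ← eLpNorm_const_mul_enorm (two_rpow_ne_top _)]
    refine eLpNorm_mono_enorm fun x => ?_
    rw [enorm_eq_self, enorm_eq_self]
    exact le_ellNorm A.q_pos (fun j : ℕ => (2 : ℝ≥0∞) ^ (A.s * j) *
      ‖bandPart (Ψ.dyadicSchwartz M j) u x‖ₑ) j

theorem le_spaceNorm_of_besov {A : SpaceParams} (hA : A.scale = Scale.B)
    {u : 𝓢'(EuclideanSpace ℝ (Fin n), ℂ)} {J : Finset ℕ} (hJ : J.Nonempty) {b : ℝ≥0∞}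
    (h : ∀ j ∈ J, b ≤
      (2 : ℝ≥0∞) ^ (A.s * j) * eLpNorm (bandPart (Ψ.dyadicSchwartz M j) u) A.p volume) :
    (J.card : ℝ≥0∞) ^ (A.q⁻¹).toReal * b ≤ spaceNorm M Ψ A u := by
  rw [spaceNorm_of_besov M Ψ hA, ← ellNorm_ite_const A.q_pos hJ]
  refine ellNorm_mono fun j => ?_
  split_ifs with hj
  · exact h j hj
  · exact zero_le

theorem dyadicSchwartz_apply (j : ℕ) (ξ : EuclideanSpace ℝ (Fin n)) :
    Ψ.dyadicSchwartz M j ξ = Ψ.dyadic M j ξ := rfl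

theorem bandPart_of_core {f : 𝓢(EuclideanSpace ℝ (Fin n), ℂ)} {k : ℕ}
    (hf : SpectrumIn f (M.core k)) (j : ℕ) (x : EuclideanSpace ℝ (Fin n)) :
    bandPart (Ψ.dyadicSchwartz M j) f x = if j = k then f x else 0 := by
  split_ifs with h
  · rw [bandPart_eq_self hf fun ξ hξ => by
      rw [dyadicSchwartz_apply, M.dyadic_of_mem_core Ψ hξ, if_pos h]]
  · rw [bandPart_eq_zero hf fun ξ hξ => by
      rw [dyadicSchwartz_apply, M.dyadic_of_mem_core Ψ hξ, if_neg h]]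
    rfl

theorem bandPart_sum_core {f : ℕ → 𝓢(EuclideanSpace ℝ (Fin n), ℂ)} {J : Finset ℕ}
    (hf : ∀ k ∈ J, SpectrumIn (f k) (M.core k)) (j : ℕ) (x : EuclideanSpace ℝ (Fin n)) :
    bandPart (Ψ.dyadicSchwartz M j) (∑ k ∈ J, f k : 𝓢(EuclideanSpace ℝ (Fin n), ℂ)) x =
      if j ∈ J then f j x else 0 := by
  rw [bandPart_sum, Finset.sum_congr rfl fun k hk => bandPart_of_core M Ψ (hf k hk) j x,
    Finset.sum_ite_eq]

theorem spaceNorm_sum_besov {A : SpaceParams} (hA : A.scale = Scale.B)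
    {f : ℕ → 𝓢(EuclideanSpace ℝ (Fin n), ℂ)} {J : Finset ℕ} (hJ : J.Nonempty)
    (hf : ∀ k ∈ J, SpectrumIn (f k) (M.core k)) {b : ℝ≥0∞}
    (hb : ∀ k ∈ J, (2 : ℝ≥0∞) ^ (A.s * k) * eLpNorm (f k) A.p volume = b) :
    spaceNorm M Ψ A (∑ k ∈ J, f k : 𝓢(EuclideanSpace ℝ (Fin n), ℂ)) =
      (J.card : ℝ≥0∞) ^ (A.q⁻¹).toReal * b := by
  rw [spaceNorm_of_besov M Ψ hA, ← ellNorm_ite_const A.q_pos hJ]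
  congr 1
  ext j
  rw [funext (bandPart_sum_core M Ψ hf j)]
  by_cases hj : j ∈ J
  · simp only [if_pos hj, ← hb j hj]
  · simp [if_neg hj]

/-- When all weighted pieces have the same modulus, the inner `ℓ_q` norm in the Triebel–Lizorkin
case is `N^{1/q} c |h(x)|` at every point, so both scales give the same value. Hence (2′) and (3′)
do not distinguish the scales. -/
theorem spaceNorm_sum_eq (A : SpaceParams)
    {f : ℕ → 𝓢(EuclideanSpace ℝ (Fin n), ℂ)} {J : Finset ℕ} (hJ : J.Nonempty)
    (hf : ∀ k ∈ J, SpectrumIn (f k) (M.core k)) {c : ℝ≥0∞} (hc : c ≠ ⊤)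
    {h : 𝓢(EuclideanSpace ℝ (Fin n), ℂ)}
    (hb : ∀ k ∈ J, ∀ x, (2 : ℝ≥0∞) ^ (A.s * k) * ‖f k x‖ₑ = c * ‖h x‖ₑ) :
    spaceNorm M Ψ A (∑ k ∈ J, f k : 𝓢(EuclideanSpace ℝ (Fin n), ℂ)) =
      (J.card : ℝ≥0∞) ^ (A.q⁻¹).toReal * (c * eLpNorm h A.p volume) := by
  cases hA : A.scale
  · refine spaceNorm_sum_besov M Ψ hA hJ hf fun k hk => ?_
    rw [← eLpNorm_const_mul_enorm (two_rpow_ne_top _), funext (hb k hk),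
      eLpNorm_const_mul_enorm hc]
  · have hcard : (J.card : ℝ≥0∞) ^ (A.q⁻¹).toReal ≠ ⊤ :=
      ENNReal.rpow_ne_top_of_nonneg ENNReal.toReal_nonneg (by simp)
    rw [spaceNorm_of_triebel M Ψ hA, ← mul_assoc,
      ← eLpNorm_const_mul_enorm (ENNReal.mul_ne_top hcard hc)]
    congr 1
    ext x
    rw [mul_assoc, ← ellNorm_ite_const A.q_pos hJ]
    congr 1
    ext j
    rw [bandPart_sum_core M Ψ hf]
    by_cases hj : j ∈ J
    · simp only [if_pos hj, hb j hj]
    · simp [if_neg hj]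

theorem spaceNorm_of_core (A : SpaceParams) {f : 𝓢(EuclideanSpace ℝ (Fin n), ℂ)} {k : ℕ}
    (hf : SpectrumIn f (M.core k)) :
    spaceNorm M Ψ A f = (2 : ℝ≥0∞) ^ (A.s * k) * eLpNorm f A.p volume := by
  have := spaceNorm_sum_eq M Ψ A (f := fun _ => f) (Finset.singleton_nonempty k) (by simpa using hf)
    (two_rpow_ne_top (A.s * k)) (h := f) (by simp)
  simpa using this

/-! ### Building blocks -/

/-- The factor `2^{-sk}`. -/
def weightFactor (s : ℝ) (k : ℕ) : ℂ := ((2 : ℝ) ^ (-(s * k)) : ℝ)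

theorem enorm_weightFactor (s : ℝ) (k : ℕ) : ‖weightFactor s k‖ₑ = (2 : ℝ≥0∞) ^ (-(s * k)) := by
  rw [weightFactor, ← ofReal_norm, Complex.norm_real, Real.norm_of_nonneg (by positivity),
    ← ENNReal.ofReal_rpow_of_pos (by norm_num)]
  simp

theorem weightFactor_mul (s t : ℝ) (k : ℕ) :
    weightFactor s k * weightFactor t k = weightFactor (s + t) k := by
  rw [weightFactor, weightFactor, weightFactor, ← Complex.ofReal_mul,
    ← Real.rpow_add (by norm_num)]
  congr 2
  ring

theorem weightFactor_zero (k : ℕ) : weightFactor 0 k = 1 := by simp [weightFactor]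

/-- The modulation `e^{iσ2^k e·x} f(x)`. -/
def modBlock (σ : ℝ) (f : 𝓢(EuclideanSpace ℝ (Fin n), ℂ)) (k : ℕ) :
    𝓢(EuclideanSpace ℝ (Fin n), ℂ) :=
  waveMul ((σ * 2 ^ k) • M.unitVector) f

/-- The modulated function `e^{iσe·x} f(x)`, dilated by `2^{kM}`. -/
def dilBlock (σ : ℝ) (f : 𝓢(EuclideanSpace ℝ (Fin n), ℂ)) (k : ℕ) :
    𝓢(EuclideanSpace ℝ (Fin n), ℂ) :=
  dilate M k (waveMul (σ • M.unitVector) f)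

theorem spectrumIn_modBlock {σ r : ℝ} {f : 𝓢(EuclideanSpace ℝ (Fin n), ℂ)}
    (hf : SpectrumIn f (M.patch 0 0 r)) (k : ℕ) :
    SpectrumIn (modBlock M σ f k) (M.patch σ k r) := by
  refine hf.waveMul _ fun ζ hζ => ?_
  rw [← zero_add r]
  refine M.patch_add_low (k := k) (by omega) (r := 0) ⟨_, ⟨0, by simp, ?_⟩, _, hζ, rfl⟩
  rw [add_zero, map_smul, M.dyadicDilation_unitVector, smul_smul, zpow_natCast]

theorem spectrumIn_dilBlock {σ r : ℝ} {f : 𝓢(EuclideanSpace ℝ (Fin n), ℂ)}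
    (hf : SpectrumIn f (M.patch 0 0 r)) (k : ℕ) :
    SpectrumIn (dilBlock M σ f k) (M.patch σ k r) := by
  refine (hf.waveMul (T := {ξ | M.dyadicDilation k ξ ∈ M.patch σ k r}) _ ?_).dilate M k
    fun ζ hζ => hζ
  rintro _ ⟨y, hy, rfl⟩
  exact ⟨y, hy, by simp [M.dyadicDilation_zero]⟩

theorem enorm_modBlock (σ : ℝ) (f : 𝓢(EuclideanSpace ℝ (Fin n), ℂ)) (k : ℕ)
    (x : EuclideanSpace ℝ (Fin n)) : ‖modBlock M σ f k x‖ₑ = ‖f x‖ₑ :=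
  enorm_waveMul_apply _ _ _

theorem enorm_dilBlock (σ : ℝ) (f : 𝓢(EuclideanSpace ℝ (Fin n), ℂ)) (k : ℕ)
    (x : EuclideanSpace ℝ (Fin n)) : ‖dilBlock M σ f k x‖ₑ = ‖f (M.dyadicDilation k x)‖ₑ :=
  enorm_waveMul_apply _ _ _

theorem eLpNorm_dilate (k : ℤ) (f : 𝓢(EuclideanSpace ℝ (Fin n), ℂ)) (p : ℝ≥0∞) :
    eLpNorm (dilate M k f) p volume =
      (2 : ℝ≥0∞) ^ (-(k * M.total * (p⁻¹).toReal)) * eLpNorm f p volume :=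
  M.eLpNorm_comp_dyadicDilation k p f

theorem eLpNorm_dilBlock (σ : ℝ) (f : 𝓢(EuclideanSpace ℝ (Fin n), ℂ)) (k : ℕ) (p : ℝ≥0∞) :
    eLpNorm (dilBlock M σ f k) p volume =
      (2 : ℝ≥0∞) ^ (-(k * M.total * (p⁻¹).toReal)) * eLpNorm f p volume := by
  rw [dilBlock, eLpNorm_dilate, Int.cast_natCast]
  congr 1
  exact eLpNorm_congr_enorm_ae (Eventually.of_forall fun x => enorm_waveMul_apply _ _ _)

/-- `∑_{k ∈ J} 2^{-sk} f_k`. -/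
def blockSum (s : ℝ) (J : Finset ℕ) (f : ℕ → 𝓢(EuclideanSpace ℝ (Fin n), ℂ)) :
    𝓢(EuclideanSpace ℝ (Fin n), ℂ) :=
  ∑ k ∈ J, weightFactor s k • f k

theorem schwartzMul_comm (f g : 𝓢(EuclideanSpace ℝ (Fin n), ℂ)) :
    schwartzMul f g = schwartzMul g f := by
  ext x
  simp only [schwartzMul_apply, mul_comm]

theorem schwartzMul_smul (a b : ℂ) (f g : 𝓢(EuclideanSpace ℝ (Fin n), ℂ)) :
    schwartzMul (a • f) (b • g) = (a * b) • schwartzMul f g := by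
  ext x
  simp only [schwartzMul_apply, smul_apply, smul_eq_mul]
  ring

theorem schwartzMul_blockSum_left (s : ℝ) (J : Finset ℕ)
    (f : ℕ → 𝓢(EuclideanSpace ℝ (Fin n), ℂ)) (g : 𝓢(EuclideanSpace ℝ (Fin n), ℂ)) :
    schwartzMul (blockSum s J f) g = blockSum s J fun k => schwartzMul (f k) g := by
  ext x
  simp only [schwartzMul_apply, blockSum, sum_apply, smul_apply, smul_eq_mul, Finset.sum_mul,
    mul_assoc]

theorem schwartzMul_blockSum_blockSum (s t : ℝ) (J : Finset ℕ)
    (f g : ℕ → 𝓢(EuclideanSpace ℝ (Fin n), ℂ)) :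
    schwartzMul (blockSum s J f) (blockSum t J g) =
      ∑ kl ∈ J ×ˢ J, (weightFactor s kl.1 * weightFactor t kl.2) • schwartzMul (f kl.1) (g kl.2) := by
  ext x
  simp only [schwartzMul_apply, blockSum, sum_apply, smul_apply, smul_eq_mul, Finset.sum_mul_sum,
    Finset.sum_product]
  refine Finset.sum_congr rfl fun k _ => Finset.sum_congr rfl fun l _ => ?_
  ring

/-- The norm of a lacunary sum of modulations. -/
theorem spaceNorm_modSum (A : SpaceParams) {σ : ℝ} (hσ : |σ| = 1) {J : Finset ℕ}
    (hJ : J.Nonempty) {f : 𝓢(EuclideanSpace ℝ (Fin n), ℂ)}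
    (hf : SpectrumIn f (M.patch 0 0 (3 * M.radius))) :
    spaceNorm M Ψ A (blockSum A.s J (modBlock M σ f)) =
      (J.card : ℝ≥0∞) ^ (A.q⁻¹).toReal * eLpNorm f A.p volume := by
  rw [blockSum, spaceNorm_sum_eq M Ψ A hJ (c := 1) (h := f) _ (by simp), one_mul]
  · intro k _ x
    rw [smul_apply, enorm_smul, enorm_weightFactor, enorm_modBlock, ← mul_assoc, two_rpow_mul,
      add_neg_cancel, ENNReal.rpow_zero]
  · exact fun k _ => ((spectrumIn_modBlock M hf k).mono (M.patch_subset_core hσ k)).const_smul _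

theorem spectrumIn_dilBlock_core {σ : ℝ} (hσ : |σ| = 1) {f : 𝓢(EuclideanSpace ℝ (Fin n), ℂ)}
    (hf : SpectrumIn f (M.patch 0 0 (3 * M.radius))) (k : ℕ) :
    SpectrumIn (dilBlock M σ f k) (M.core k) :=
  (spectrumIn_dilBlock M hf k).mono (M.patch_subset_core hσ k)

/-- The weight `s - |M|/p` normalises every concentrated block. Their moduli differ pointwise, only
their `L_p` norms agree after weighting, and so the formula is special to the Besov scale. -/
theorem spaceNorm_dilSum_besov {A : SpaceParams} (hA : A.scale = Scale.B) {σ : ℝ} (hσ : |σ| = 1)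
    {J : Finset ℕ} (hJ : J.Nonempty) {f : 𝓢(EuclideanSpace ℝ (Fin n), ℂ)}
    (hf : SpectrumIn f (M.patch 0 0 (3 * M.radius))) :
    spaceNorm M Ψ A (blockSum (A.s - M.total * A.recip) J (dilBlock M σ f)) =
      (J.card : ℝ≥0∞) ^ (A.q⁻¹).toReal * eLpNorm f A.p volume := by
  rw [blockSum, spaceNorm_sum_besov M Ψ hA hJ]
  · exact fun k _ => (spectrumIn_dilBlock_core M hσ hf k).const_smul _
  · intro k _
    have h : (⇑(weightFactor (A.s - M.total * A.recip) k • dilBlock M σ f k) :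
        EuclideanSpace ℝ (Fin n) → ℂ) =
        weightFactor (A.s - M.total * A.recip) k • ⇑(dilBlock M σ f k) := rfl
    rw [h, eLpNorm_const_smul, enorm_weightFactor, eLpNorm_dilBlock, ← mul_assoc, ← mul_assoc,
      two_rpow_mul, two_rpow_mul, A.recip_eq]
    convert one_mul _
    convert ENNReal.rpow_zero
    ring

theorem spaceNorm_dilBlock (A : SpaceParams) {σ : ℝ} (hσ : |σ| = 1)
    {f : 𝓢(EuclideanSpace ℝ (Fin n), ℂ)}
    (hf : SpectrumIn f (M.patch 0 0 (3 * M.radius))) (k : ℕ) :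
    spaceNorm M Ψ A (dilBlock M σ f k) =
      (2 : ℝ≥0∞) ^ ((A.s - M.total * A.recip) * k) * eLpNorm f A.p volume := by
  rw [spaceNorm_of_core M Ψ A (spectrumIn_dilBlock_core M hσ hf k), eLpNorm_dilBlock, ← mul_assoc,
    two_rpow_mul, A.recip_eq]
  congr 2
  ring

/-! ### The basic low-frequency function -/

/-- Take the Fourier transform of an even real bump `φ`. Then `f(0) = ∫ φ > 0`, and the transform of
`f²` at 0 is `∫ f² = ∫ φ(x)φ(-x) dx = ∫ φ² > 0`. The first value makes products near the origin
nonzero, the second gives concentrated squares a low-frequency part. -/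
theorem exists_base : ∃ f : 𝓢(EuclideanSpace ℝ (Fin n), ℂ),
    SpectrumIn f (M.patch 0 0 M.radius) ∧ f 0 ≠ 0 ∧ 𝓕 (schwartzMul f f) 0 ≠ 0 := by
  have hr : 0 < M.radius / (2 * Real.pi) := div_pos M.radius_pos Real.two_pi_pos
  let φ : ContDiffBump (0 : EuclideanSpace ℝ (Fin n)) :=
    -- Division by `2π` because spectra are measured in the variable `2πη`.
    ⟨M.radius / (2 * Real.pi) / 2, M.radius / (2 * Real.pi), by positivity, by linarith⟩
  have hcs : HasCompactSupport fun x => (φ x : ℂ) := φ.hasCompactSupport.comp_left (g := Complex.ofReal) rfl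
  let Φ : 𝓢(EuclideanSpace ℝ (Fin n), ℂ) := hcs.toSchwartzMap
    (Complex.ofRealCLM.contDiff.comp φ.contDiff)
  have hΦ : ∀ x, Φ x = (φ x : ℂ) := fun x => rfl
  have hFF : ∀ x, 𝓕 (𝓕 Φ) x = Φ (-x) := by
    intro x
    have h : Φ (-x) = 𝓕⁻ (𝓕 Φ) (-x) := by rw [FourierTransform.fourierInv_fourier_eq]
    rw [h, SchwartzMap.fourierInv_coe, Real.fourierInv_eq_fourier_neg, neg_neg,
      SchwartzMap.fourier_coe (𝓕 Φ)]
  refine ⟨𝓕 Φ, ?_, ?_, ?_⟩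
  · intro η hη
    rw [hFF, hΦ, Complex.ofReal_ne_zero, ← Function.mem_support, φ.support_eq,
      mem_ball_zero_iff, norm_neg] at hη
    change ‖η‖ < M.radius / (2 * Real.pi) at hη
    rw [lt_div_iff₀ Real.two_pi_pos] at hη
    refine ⟨(2 * Real.pi) • η, ?_, by simp [M.dyadicDilation_zero]⟩
    rw [norm_smul, Real.norm_of_nonneg Real.two_pi_pos.le]
    linarith
  · rw [SchwartzMap.fourier_coe, Real.fourier_eq']
    simp only [inner_zero_right, mul_zero, Complex.ofReal_zero, zero_mul, Complex.exp_zero,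
      one_smul, hΦ]
    rw [integral_complex_ofReal, Complex.ofReal_ne_zero]
    exact φ.integral_pos.ne'
  · rw [SchwartzMap.fourier_coe, Real.fourier_eq']
    simp only [inner_zero_right, mul_zero, Complex.ofReal_zero, zero_mul, Complex.exp_zero,
      one_smul, schwartzMul_apply]
    rw [SchwartzMap.integral_fourier_mul_eq]
    simp only [hFF, hΦ, φ.neg, ← Complex.ofReal_mul]
    rw [integral_complex_ofReal, Complex.ofReal_ne_zero]
    refine ne_of_gt (Continuous.integral_pos_of_hasCompactSupport_nonneg_nonzero (x := 0)
      (φ.continuous.mul φ.continuous) φ.hasCompactSupport.mul_right (fun x => mul_self_nonneg _) ?_)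
    rw [φ.one_of_mem_closedBall (by simp [φ.rIn_pos.le])]
    norm_num

end Norms

end

noncomputable section

section Limits

variable {n : ℕ} (M : AnisotropicWeight n) (Ψ : DyadicCutoff)

/-! ### The product `π` of Schwartz functions -/

theorem norm_planeWave (x η : EuclideanSpace ℝ (Fin n)) :
    ‖Complex.exp (2 * Real.pi * Complex.I * (inner ℝ x η : ℝ))‖ = 1 := by
  have : (2 * Real.pi * Complex.I * (inner ℝ x η : ℝ) : ℂ) =
      ((2 * Real.pi * inner ℝ x η : ℝ) : ℂ) * Complex.I := by push_cast; ring
  rw [this, Complex.norm_exp_ofReal_mul_I]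

theorem continuous_planeWave (x : EuclideanSpace ℝ (Fin n)) :
    Continuous fun η => Complex.exp (2 * Real.pi * Complex.I * (inner ℝ x η : ℝ)) := by
  fun_prop

theorem tendsto_dyadicDilation_neg (x : EuclideanSpace ℝ (Fin n)) :
    Tendsto (fun k : ℕ => M.dyadicDilation (-k) x) atTop (𝓝 0) := by
  rw [tendsto_zero_iff_norm_tendsto_zero]
  have h : Tendsto (fun k : ℕ => (1 / 2 : ℝ) ^ k * ‖x‖) atTop (𝓝 0) := by
    simpa using (tendsto_pow_atTop_nhds_zero_of_lt_one (by norm_num : (0 : ℝ) ≤ 1 / 2)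
      (by norm_num)).mul_const ‖x‖
  refine squeeze_zero (fun k => norm_nonneg _) (fun k => ?_) h
  refine (M.norm_dyadicDilation_le (by omega) x).trans (le_of_eq ?_)
  rw [zpow_neg, zpow_natCast, one_div, inv_pow]

/-- For Schwartz functions, `π(f, g) = f g`. -/
theorem isProduct_schwartzMul (f g : 𝓢(EuclideanSpace ℝ (Fin n), ℂ)) :
    IsProduct M f g (schwartzMul f g) := by
  intro ψ _ hψ1 φ _
  obtain ⟨C, -, hC⟩ := ψ.decay 0 0
  simp only [pow_zero, one_mul, norm_iteratedFDeriv_zero] at hC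
  have hC0 : 0 ≤ C := (norm_nonneg _).trans (hC 0)
  let ψk : ℕ → 𝓢(EuclideanSpace ℝ (Fin n), ℂ) := fun k =>
    SchwartzMap.compCLMOfContinuousLinearEquiv ℂ (M.dyadicDilation (-k)) ψ
  have hψk : ∀ k ξ, ψk k ξ = ψ (M.dyadicDilation (-k) ξ) := fun k ξ => rfl
  -- A bound uniform in `k` and `x`; multiplied by `|φ|` it dominates the final integrals.
  have hbound : ∀ (u : 𝓢(EuclideanSpace ℝ (Fin n), ℂ)) k x,
      ‖bandPart (ψk k) u x‖ ≤ C * ∫ η, ‖𝓕 u η‖ := by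
    intro u k x
    rw [bandPart_coe, ← integral_const_mul]
    refine norm_integral_le_of_norm_le ((𝓕 u).integrable.norm.const_mul C)
      (Eventually.of_forall fun η => ?_)
    rw [norm_mul, norm_mul, norm_planeWave, one_mul]
    gcongr
    exact hC _
  have hlim : ∀ (u : 𝓢(EuclideanSpace ℝ (Fin n), ℂ)) x,
      Tendsto (fun k => bandPart (ψk k) u x) atTop (𝓝 (u x)) := by
    intro u x
    simp only [bandPart_coe]
    rw [eq_integral_fourier u x]
    refine tendsto_integral_of_dominated_convergence (fun η => C * ‖𝓕 u η‖) (fun k => ?_)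
      ((𝓕 u).integrable.norm.const_mul C) (fun k => Eventually.of_forall fun η => ?_)
      (Eventually.of_forall fun η => ?_)
    · refine Continuous.aestronglyMeasurable ?_
      refine ((continuous_planeWave x).mul ((ψk k).continuous.comp (continuous_const_smul _))).mul
        (𝓕 u).continuous
    · rw [norm_mul, norm_mul, norm_planeWave, one_mul]
      gcongr
      exact hC _
    -- For fixed `η` the dilated frequency enters the neighbourhood where `ψ = 1`, so the integrand
    -- is eventually constant in `k`.
    · have h := (tendsto_dyadicDilation_neg M ((2 * Real.pi) • η)).eventually hψ1
      refine tendsto_const_nhds.congr' ?_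
      filter_upwards [h] with k hk
      rw [hψk, hk, mul_one]
  have hmeas : ∀ (u : 𝓢(EuclideanSpace ℝ (Fin n), ℂ)) k, Continuous (bandPart (ψk k) u) := by
    intro u k
    simp only [funext (bandPart_coe (ψk k) u)]
    refine continuous_of_dominated (bound := fun η => C * ‖𝓕 u η‖) (fun x => ?_)
      (fun x => Eventually.of_forall fun η => ?_) ((𝓕 u).integrable.norm.const_mul C)
      (Eventually.of_forall fun η => ?_)
    · refine Continuous.aestronglyMeasurable ?_
      refine ((continuous_planeWave x).mul ((ψk k).continuous.comp (continuous_const_smul _))).mul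
        (𝓕 u).continuous
    · rw [norm_mul, norm_mul, norm_planeWave, one_mul]
      gcongr
      exact hC _
    · fun_prop
  rw [SchwartzMap.coe_apply]
  refine tendsto_integral_of_dominated_convergence
    (fun x => (C * ∫ η, ‖𝓕 f η‖) * (C * ∫ η, ‖𝓕 g η‖) * ‖φ x‖) (fun k => ?_)
    (φ.integrable.norm.const_mul _) (fun k => Eventually.of_forall fun x => ?_)
    (Eventually.of_forall fun x => ?_)
  · exact (((hmeas f k).mul (hmeas g k)).mul φ.continuous).aestronglyMeasurable
  · rw [norm_mul, norm_mul]
    have h1 := hbound f k x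
    have h2 := hbound g k x
    gcongr
    · exact h1
    · exact h2
  · rw [smul_eq_mul, schwartzMul_apply, mul_comm (φ x)]
    exact ((hlim f x).mul (hlim g x)).mul_const _

/-! ### Lower bounds -/

theorem eLpNorm_indicator_ne_zero {f : EuclideanSpace ℝ (Fin n) → ℂ} (hf : Continuous f)
    {x₀ : EuclideanSpace ℝ (Fin n)} (h0 : f x₀ ≠ 0) {U : Set (EuclideanSpace ℝ (Fin n))}
    (hU : IsOpen U) (hx₀ : x₀ ∈ U) {p : ℝ≥0∞} (hp : p ≠ 0) :
    eLpNorm (U.indicator f) p volume ≠ 0 := by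
  rw [Ne, eLpNorm_eq_zero_iff (hf.aestronglyMeasurable.indicator hU.measurableSet) hp]
  intro h
  have hopen : IsOpen (U ∩ {x | f x ≠ 0}) := hU.inter (isOpen_ne_fun hf continuous_const)
  refine (hopen.measure_pos volume ⟨x₀, hx₀, h0⟩).ne' (measure_mono_null ?_ h)
  intro x hx
  simpa [hx.1] using hx.2

theorem eLpNorm_ne_zero {f : 𝓢(EuclideanSpace ℝ (Fin n), ℂ)} {x₀ : EuclideanSpace ℝ (Fin n)}
    (h0 : f x₀ ≠ 0) {p : ℝ≥0∞} (hp : p ≠ 0) : eLpNorm f p volume ≠ 0 := by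
  simpa using eLpNorm_indicator_ne_zero f.continuous h0 isOpen_univ (Set.mem_univ _) hp

/-- Multiplication of a strongly concentrated block by a function that is nonzero at the origin. -/
theorem eventually_le_eLpNorm_mul_dilBlock {u f : 𝓢(EuclideanSpace ℝ (Fin n), ℂ)}
    (hu : u 0 ≠ 0) (σ : ℝ) (p : ℝ≥0∞) : ∀ᶠ k : ℕ in atTop,
      ‖u 0‖ₑ / 2 * ((2 : ℝ≥0∞) ^ (-(k * M.total * (p⁻¹).toReal)) *
        eLpNorm ((Metric.ball 0 1).indicator f) p volume) ≤
      eLpNorm (schwartzMul u (dilBlock M σ f k)) p volume := by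
  have hlt : ‖u 0‖ₑ / 2 < ‖u 0‖ₑ := ENNReal.half_lt_self (by simpa using hu) (by simp)
  -- On a ball of radius `r` we have `|u| ≥ |u(0)|/2`, and for large `k` the contracted unit ball
  -- `2^{-kM}B_1` lies in it. Restricting the block to this region gives the bound.
  obtain ⟨r, hr, hball⟩ := Metric.eventually_nhds_iff_ball.mp
    (u.continuous.enorm.continuousAt.eventually (lt_mem_nhds hlt))
  have hk : ∀ᶠ k : ℕ in atTop, (1 / 2 : ℝ) ^ k < r :=
    (tendsto_pow_atTop_nhds_zero_of_lt_one (by norm_num) (by norm_num)).eventually (gt_mem_nhds hr)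
  filter_upwards [hk] with k hk
  have hcast : (k * M.total * (p⁻¹).toReal : ℝ) = ((k : ℤ) : ℝ) * M.total * (p⁻¹).toReal := by simp
  rw [hcast, ← M.eLpNorm_comp_dyadicDilation,
    ← eLpNorm_const_mul_enorm (ENNReal.div_ne_top (by simp) (by norm_num))]
  refine eLpNorm_mono_enorm fun x => ?_
  rw [enorm_eq_self, schwartzMul_apply, enorm_mul, enorm_dilBlock]
  by_cases hx : M.dyadicDilation k x ∈ Metric.ball (0 : EuclideanSpace ℝ (Fin n)) 1
  · rw [Set.indicator_of_mem hx]
    gcongr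
    refine (hball x ?_).le
    rw [mem_ball_zero_iff] at hx ⊢
    rw [← M.dyadicDilation_neg_cancel k x]
    refine (M.norm_dyadicDilation_le (by omega) _).trans_lt (lt_of_le_of_lt ?_ hk)
    rw [zpow_neg, zpow_natCast, one_div, inv_pow]
    exact mul_le_of_le_one_right (by positivity) hx.le
  · rw [Set.indicator_of_notMem hx]
    simp

/-- The low-frequency part of a concentrated function, after rescaling, converges uniformly. -/
theorem eventually_norm_bandPart_dilate_sub_le (χ h : 𝓢(EuclideanSpace ℝ (Fin n), ℂ)) {δ : ℝ}
    (hδ : 0 < δ) : ∀ᶠ k : ℕ in atTop, ∀ x,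
      ‖((2 : ℝ) ^ (k * M.total) : ℝ) * bandPart χ (dilate M k h) x -
        𝓕 h 0 * ∫ η, Complex.exp (2 * Real.pi * Complex.I * (inner ℝ x η : ℝ)) *
          χ ((2 * Real.pi) • η)‖ ≤ δ := by
  obtain ⟨C, -, hC⟩ := (𝓕 h).decay 0 0
  simp only [pow_zero, one_mul, norm_iteratedFDeriv_zero] at hC
  let χ' : 𝓢(EuclideanSpace ℝ (Fin n), ℂ) :=
    SchwartzMap.compCLMOfContinuousLinearEquiv ℂ (twoPiScaling n) χ
  have hχ' : ∀ η, χ' η = χ ((2 * Real.pi) • η) := fun η => rfl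
  -- After rescaling, the difference is a Fourier integral of this integrand. Its `L_1` norm does
  -- not involve `x`, so convergence is uniform.
  have hlim : Tendsto (fun k : ℕ => ∫ η, ‖χ' η * (𝓕 h (M.dyadicDilation (-k) η) - 𝓕 h 0)‖) atTop
      (𝓝 0) := by
    rw [← integral_zero (EuclideanSpace ℝ (Fin n)) ℝ]
    refine tendsto_integral_of_dominated_convergence (fun η => ‖χ' η‖ * (C + C)) (fun k => ?_)
      (χ'.integrable.norm.mul_const _) (fun k => Eventually.of_forall fun η => ?_)
      (Eventually.of_forall fun η => ?_)
    · exact (χ'.continuous.mul (((𝓕 h).continuous.comp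
        (M.dyadicDilation (-k)).continuous).sub continuous_const)).norm.aestronglyMeasurable
    · rw [norm_norm, norm_mul]
      gcongr
      exact (norm_sub_le _ _).trans (add_le_add (hC _) (hC _))
    · have h1 := ((𝓕 h).continuous.tendsto 0).comp (tendsto_dyadicDilation_neg M η)
      have h2 := ((h1.sub_const (𝓕 h 0)).const_mul (χ' η)).norm
      simpa using h2
  filter_upwards [hlim.eventually (gt_mem_nhds hδ)] with k hk x
  refine le_trans ?_ hk.le
  have h2 : ((2 : ℝ) ^ (k * M.total) : ℝ) * ((2 : ℝ) ^ (-(k * M.total)) : ℝ) = (1 : ℂ) := by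
    rw [← Complex.ofReal_mul, ← Real.rpow_add (by norm_num), add_neg_cancel, Real.rpow_zero,
      Complex.ofReal_one]
  have hint : ∀ F : EuclideanSpace ℝ (Fin n) → ℂ, Continuous F → (∀ η, ‖F η‖ ≤ C) → Integrable
      fun η => Complex.exp (2 * Real.pi * Complex.I * (inner ℝ x η : ℝ)) *
        χ' η * F η := by
    intro F hF hFC
    refine (χ'.integrable.norm.mul_const C).mono'
      (((continuous_planeWave x).mul χ'.continuous).mul hF).aestronglyMeasurable
      (Eventually.of_forall fun η => ?_)
    rw [norm_mul, norm_mul, norm_planeWave, one_mul]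
    gcongr
    exact hFC η
  rw [bandPart_coe, ← integral_const_mul, mul_comm (𝓕 h 0), ← integral_mul_const]
  simp only [fourier_dilate, ← hχ', Int.cast_natCast]
  rw [integral_congr_ae (g := fun η => Complex.exp (2 * Real.pi * Complex.I * (inner ℝ x η : ℝ)) *
        χ' η * 𝓕 h (M.dyadicDilation (-k) η)) (Eventually.of_forall fun η => by
      simp only []
      rw [mul_left_comm, ← mul_assoc (((2 : ℝ) ^ (k * M.total) : ℝ) : ℂ), h2, one_mul]),
    ← integral_sub (hint _ ((𝓕 h).continuous.comp (M.dyadicDilation (-k)).continuous)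
      fun η => hC _) (hint _ continuous_const fun η => hC 0)]
  refine (norm_integral_le_integral_norm _).trans (le_of_eq ?_)
  refine integral_congr_ae (Eventually.of_forall fun η => ?_)
  simp only []
  rw [← mul_sub, mul_assoc, norm_mul, norm_planeWave, one_mul]

/-- The kernel is the inverse transform of the rescaled `Φ_0`, which cannot vanish identically
because `Φ_0(0) = 1`. -/
theorem exists_kernel_ne_zero : ∃ x : EuclideanSpace ℝ (Fin n),
    ∫ η, Complex.exp (2 * Real.pi * Complex.I * (inner ℝ x η : ℝ)) *
      Ψ.dyadicSchwartz M 0 ((2 * Real.pi) • η) ≠ 0 := by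
  by_contra! h
  let χ' : 𝓢(EuclideanSpace ℝ (Fin n), ℂ) :=
    SchwartzMap.compCLMOfContinuousLinearEquiv ℂ (twoPiScaling n) (Ψ.dyadicSchwartz M 0)
  have h1 : 𝓕⁻ χ' = 0 := by
    ext x
    rw [eq_integral_fourier, FourierTransform.fourier_fourierInv_eq]
    exact h x
  have h2 : χ' = 0 := by
    have h4 : 𝓕 (𝓕⁻ χ') = χ' := FourierTransform.fourier_fourierInv_eq χ'
    rw [← h4, h1]
    exact map_zero (FourierTransform.fourierCLM ℂ 𝓢(EuclideanSpace ℝ (Fin n), ℂ))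
  have h3 : χ' 0 = 1 := by
    change Ψ.dyadicSchwartz M 0 ((2 * Real.pi) • 0) = 1
    rw [smul_zero, dyadicSchwartz_apply, M.dyadic_of_mem_core Ψ (k := 0), if_pos rfl]
    refine ⟨?_, fun h => absurd rfl h⟩
    rw [M.size_zero]
    norm_num
  rw [h2] at h3
  simp at h3

/-- Lower bound for the low-frequency part of a sum of concentrated functions. -/
theorem exists_le_eLpNorm_bandPart_dilates {h : 𝓢(EuclideanSpace ℝ (Fin n), ℂ)}
    (hh : 𝓕 h 0 ≠ 0) {p : ℝ≥0∞} (hp : p ≠ 0) : ∃ c : ℝ≥0∞, c ≠ 0 ∧ ∃ K : ℕ, ∀ J : Finset ℕ,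
      (∀ k ∈ J, K ≤ k) → J.card * c ≤ eLpNorm (fun x => ∑ k ∈ J, ((2 : ℝ) ^ (k * M.total) : ℝ) *
        bandPart (Ψ.dyadicSchwartz M 0) (dilate M k h) x) p volume := by
  obtain ⟨x₀, hx₀⟩ := exists_kernel_ne_zero M Ψ
  let χ' : 𝓢(EuclideanSpace ℝ (Fin n), ℂ) :=
    SchwartzMap.compCLMOfContinuousLinearEquiv ℂ (twoPiScaling n) (Ψ.dyadicSchwartz M 0)
  let w : 𝓢(EuclideanSpace ℝ (Fin n), ℂ) := 𝓕⁻ χ'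
  have hw : ∀ x, w x = ∫ η, Complex.exp (2 * Real.pi * Complex.I * (inner ℝ x η : ℝ)) *
      Ψ.dyadicSchwartz M 0 ((2 * Real.pi) • η) := by
    intro x
    rw [eq_integral_fourier, FourierTransform.fourier_fourierInv_eq]
    rfl
  rw [← hw] at hx₀
  have hw0 : 0 < ‖𝓕 h 0 * w x₀‖ := norm_pos_iff.mpr (mul_ne_zero hh hx₀)
  -- On `U` the limit exceeds `2δ` and each of the `N` terms is within `δ` of it. No cancellation
  -- can occur, and the sum has modulus at least `Nδ`.
  set δ : ℝ := ‖𝓕 h 0 * w x₀‖ / 4 with hδ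
  have hδ0 : 0 < δ := by positivity
  obtain ⟨K, hK⟩ := eventually_atTop.mp
    (eventually_norm_bandPart_dilate_sub_le M (Ψ.dyadicSchwartz M 0) h hδ0)
  let U : Set (EuclideanSpace ℝ (Fin n)) := {x | 2 * δ < ‖𝓕 h 0 * w x‖}
  have hU : IsOpen U := isOpen_lt continuous_const (continuous_const.mul w.continuous).norm
  have hxU : x₀ ∈ U := by
    change 2 * δ < _
    linarith
  refine ⟨eLpNorm (U.indicator fun _ => (δ : ℂ)) p volume,
    eLpNorm_indicator_ne_zero continuous_const (x₀ := x₀)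
      (Complex.ofReal_ne_zero.mpr hδ0.ne') hU hxU hp, K, fun J hJ => ?_⟩
  rw [← eLpNorm_const_mul_enorm (by simp)]
  refine eLpNorm_mono_enorm fun x => ?_
  rw [enorm_eq_self]
  by_cases hx : x ∈ U
  · rw [Set.indicator_of_mem hx]
    have h1 : ‖(J.card : ℂ) * (𝓕 h 0 * w x) - ∑ k ∈ J, ((2 : ℝ) ^ (k * M.total) : ℝ) *
        bandPart (Ψ.dyadicSchwartz M 0) (dilate M k h) x‖ ≤ J.card * δ := by
      rw [norm_sub_rev, ← nsmul_eq_mul, ← Finset.sum_const, ← Finset.sum_sub_distrib]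
      refine (norm_sum_le _ _).trans ?_
      rw [← nsmul_eq_mul, ← Finset.sum_const]
      refine Finset.sum_le_sum fun k hk => ?_
      have := hK k (hJ k hk) x
      rwa [← hw] at this
    have h2 : (J.card : ℝ) * (2 * δ) ≤ ‖(J.card : ℂ) * (𝓕 h 0 * w x)‖ := by
      rw [norm_mul (J.card : ℂ), Complex.norm_natCast]
      exact mul_le_mul_of_nonneg_left (le_of_lt hx) (by positivity)
    have h3 : (J.card : ℝ) * δ ≤ ‖∑ k ∈ J, ((2 : ℝ) ^ (k * M.total) : ℝ) *
        bandPart (Ψ.dyadicSchwartz M 0) (dilate M k h) x‖ := by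
      have := norm_le_norm_add_norm_sub (∑ k ∈ J, ((2 : ℝ) ^ (k * M.total) : ℝ) *
        bandPart (Ψ.dyadicSchwartz M 0) (dilate M k h) x) ((J.card : ℂ) * (𝓕 h 0 * w x))
      rw [norm_sub_rev] at this
      linarith
    have h4 : (J.card : ℝ≥0∞) * ‖(δ : ℂ)‖ₑ = ENNReal.ofReal (J.card * δ) := by
      rw [ENNReal.ofReal_mul (by positivity), ENNReal.ofReal_natCast, ← ofReal_norm,
        Complex.norm_real, Real.norm_of_nonneg hδ0.le]
    rw [h4, ← ofReal_norm]
    exact ENNReal.ofReal_le_ofReal h3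
  · rw [Set.indicator_of_notMem hx]
    simp

end Limits

end

noncomputable section

/-! ### Sequences with a single peak -/

/-- Distinct exponents mean the sum is dominated by part of the full geometric series. -/
theorem sum_le_geometric {J : Finset ℕ} {e : ℕ → ℕ} (he : Set.InjOn e J) {x : ℕ → ℝ≥0∞}
    {μ ρ : ℝ≥0∞} (h : ∀ k ∈ J, x k ≤ μ * ρ ^ e k) : ∑ k ∈ J, x k ≤ μ * (1 - ρ)⁻¹ := by
  refine (Finset.sum_le_sum h).trans ?_
  rw [← Finset.mul_sum, ← Finset.sum_image (f := fun i => ρ ^ i) he, ← ENNReal.tsum_geometric]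
  gcongr
  exact ENNReal.sum_le_tsum _

/-- The `ℓ_q` quasi-norm of a sequence that decays geometrically on both sides of a peak is
comparable to its largest element. -/
theorem exists_ellNorm_le_of_peak {q ρ : ℝ≥0∞} (hq : 0 < q) (hρ : ρ < 1) :
    ∃ C : ℝ≥0∞, C ≠ ⊤ ∧ ∀ (b : ℕ → ℝ≥0∞) (J : Finset ℕ) (P : ℕ → Prop), J.Nonempty →
      (∀ k ∈ J, ∀ l ∈ J, P k → P l → k ≤ l → b k ≤ ρ ^ (l - k) * b l) →
      (∀ k ∈ J, ∀ l ∈ J, ¬ P k → ¬ P l → l ≤ k → b k ≤ ρ ^ (k - l) * b l) →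
      ∃ k ∈ J, ellNorm q (fun j => if j ∈ J then b j else 0) ≤ C * b k := by
  classical
  by_cases hqt : q = ⊤
  · refine ⟨1, by simp, fun b J _ hJ _ _ => ?_⟩
    obtain ⟨k, hk, hmax⟩ := J.exists_max_image b hJ
    refine ⟨k, hk, ?_⟩
    rw [ellNorm, if_pos hqt, one_mul]
    refine iSup_le fun j => ?_
    split_ifs with hj
    · exact hmax j hj
    · exact zero_le
  have hq' : 0 < q.toReal := ENNReal.toReal_pos hq.ne' hqt
  have hρq : ρ ^ q.toReal < 1 := ENNReal.rpow_lt_one hρ hq'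
  set D : ℝ≥0∞ := (1 - ρ ^ q.toReal)⁻¹
  have hD : D ≠ ⊤ := ENNReal.inv_ne_top.mpr (tsub_pos_of_lt hρq).ne'
  refine ⟨(D + D) ^ (1 / q.toReal), ENNReal.rpow_ne_top_of_nonneg (by positivity) (by simp [hD]),
    fun b J P hJ h1 h2 => ?_⟩
  -- The rising part (`P`) is compared with its last element and the falling part with its first;
  -- both are at most the global maximum `b m`. Each part costs one geometric series `D`.
  obtain ⟨m, hm, hmax⟩ := J.exists_max_image b hJ
  refine ⟨m, hm, ?_⟩
  have step : ∀ k l i : ℕ, l ∈ J → b k ≤ ρ ^ i * b l →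
      b k ^ q.toReal ≤ b m ^ q.toReal * (ρ ^ q.toReal) ^ i := by
    intro k l i hl h
    calc b k ^ q.toReal ≤ (ρ ^ i * b m) ^ q.toReal := by
          gcongr
          exact h.trans (by gcongr; exact hmax l hl)
      _ = _ := by
          rw [ENNReal.mul_rpow_of_nonneg _ _ hq'.le, ← ENNReal.rpow_natCast, ← ENNReal.rpow_mul,
            ← ENNReal.rpow_natCast, ← ENNReal.rpow_mul, mul_comm, mul_comm q.toReal]
  have hleft : ∑ k ∈ J with P k, b k ^ q.toReal ≤ b m ^ q.toReal * D := by
    rcases (J.filter P).eq_empty_or_nonempty with he | hne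
    · simp [he]
    set l := (J.filter P).max' hne
    obtain ⟨hl, hPl⟩ := Finset.mem_filter.mp ((J.filter P).max'_mem hne)
    have hle : ∀ k ∈ J.filter P, k ≤ l := fun k hk => Finset.le_max' _ k hk
    refine sum_le_geometric (e := fun k => l - k) (fun k hk k' hk' hkk => ?_) fun k hk => ?_
    · have := hle k hk
      have := hle k' hk'
      simp only at hkk
      omega
    · obtain ⟨hkJ, hPk⟩ := Finset.mem_filter.mp hk
      exact step k l (l - k) hl (h1 k hkJ l hl hPk hPl (hle k hk))
  have hright : ∑ k ∈ J with ¬ P k, b k ^ q.toReal ≤ b m ^ q.toReal * D := by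
    rcases (J.filter fun k => ¬ P k).eq_empty_or_nonempty with he | hne
    · simp [he]
    set l := (J.filter fun k => ¬ P k).min' hne
    obtain ⟨hl, hPl⟩ := Finset.mem_filter.mp ((J.filter fun k => ¬ P k).min'_mem hne)
    have hle : ∀ k ∈ J.filter (fun k => ¬ P k), l ≤ k := fun k hk => Finset.min'_le _ k hk
    refine sum_le_geometric (e := fun k => k - l) (fun k hk k' hk' hkk => ?_) fun k hk => ?_
    · have := hle k hk
      have := hle k' hk'
      simp only at hkk
      omega
    · obtain ⟨hkJ, hPk⟩ := Finset.mem_filter.mp hk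
      exact step k l (k - l) hl (h2 k hkJ l hl hPk hPl (hle k hk))
  rw [ellNorm, if_neg hqt, tsum_eq_sum (s := J) (fun j hj => by simp [hj, hq']),
    Finset.sum_congr rfl (g := fun k => b k ^ q.toReal) (fun j hj => by simp [hj]),
    ← Finset.sum_filter_add_sum_filter_not J P]
  calc _ ≤ (b m ^ q.toReal * D + b m ^ q.toReal * D) ^ (1 / q.toReal) := by
        gcongr
    _ = _ := by
      rw [← mul_add, mul_comm, ENNReal.mul_rpow_of_nonneg _ _ (by positivity), ← ENNReal.rpow_mul,
        mul_one_div_cancel hq'.ne', ENNReal.rpow_one]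

/-- Pointwise `H^p` is at most the sum of the `h_k^p`, whichever `k` works at that point. No
triangle inequality is used, so `p < 1` is allowed. -/
theorem eLpNorm_le_of_forall_exists {α : Type*} [MeasurableSpace α] {μ : Measure α} {p : ℝ≥0∞}
    (hp0 : p ≠ 0) (hp : p ≠ ⊤) {J : Finset ℕ} {H : α → ℝ≥0∞} {h : ℕ → α → ℝ≥0∞}
    (hmeas : ∀ k ∈ J, Measurable (h k)) {D : ℝ≥0∞} (hD : ∀ k ∈ J, eLpNorm (h k) p μ ≤ D)
    (hH : ∀ x, ∃ k ∈ J, H x ≤ h k x) :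
    eLpNorm H p μ ≤ (J.card : ℝ≥0∞) ^ (p⁻¹).toReal * D := by
  have hp' : 0 < p.toReal := ENNReal.toReal_pos hp0 hp
  have hk : ∀ k ∈ J, ∫⁻ x, h k x ^ p.toReal ∂μ ≤ D ^ p.toReal := by
    intro k hk
    have := ENNReal.rpow_le_rpow (hD k hk) hp'.le
    rw [eLpNorm_eq_lintegral_rpow_enorm_toReal hp0 hp, ← ENNReal.rpow_mul,
      one_div_mul_cancel hp'.ne', ENNReal.rpow_one] at this
    simpa only [enorm_eq_self] using this
  rw [eLpNorm_eq_lintegral_rpow_enorm_toReal hp0 hp]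
  simp only [enorm_eq_self]
  calc (∫⁻ x, H x ^ p.toReal ∂μ) ^ (1 / p.toReal)
      ≤ (∫⁻ x, ∑ k ∈ J, h k x ^ p.toReal ∂μ) ^ (1 / p.toReal) := by
        gcongr with x
        obtain ⟨k, hkJ, hkx⟩ := hH x
        refine (ENNReal.rpow_le_rpow hkx hp'.le).trans ?_
        exact Finset.single_le_sum (f := fun k => h k x ^ p.toReal) (fun _ _ => zero_le) hkJ
    _ ≤ (J.card * D ^ p.toReal) ^ (1 / p.toReal) := by
        rw [lintegral_finsetSum J fun k hk => (hmeas k hk).pow_const _, ← nsmul_eq_mul,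
          ← Finset.sum_const]
        gcongr with k hkJ
        exact hk k hkJ
    _ = _ := by
        rw [ENNReal.mul_rpow_of_nonneg _ _ (by positivity), ← ENNReal.rpow_mul,
          mul_one_div_cancel hp'.ne', ENNReal.rpow_one, ENNReal.toReal_inv, one_div]

/-! ### Triebel–Lizorkin quasi-norms of concentrated sums -/

section Triebel

variable {n : ℕ} (M : AnisotropicWeight n) (Ψ : DyadicCutoff)

theorem AnisotropicWeight.max_one_size_le (x : EuclideanSpace ℝ (Fin n)) :
    max 1 (M.size x) ≤ 1 + ‖x‖ := by
  refine max_le (by linarith [norm_nonneg x]) ?_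
  by_contra! h
  have h1 : 1 < M.size x := by linarith [norm_nonneg x]
  have h0 : x ≠ 0 := by
    rintro rfl
    rw [M.size_zero] at h1
    linarith
  have h2 := M.sum_le (x := x) h1.le
  rw [(M.size_spec h0).2, one_le_div (by positivity)] at h2
  have h3 := abs_le_of_sq_le_sq h2 (norm_nonneg x)
  have := le_abs_self (M.size x)
  linarith

/-- Each weight is at most `|M|`, so the norm grows at most like the power `|M|` of `[x]`. Decay in
`[x]`, which scales exactly under dilations, can thus be turned into decay in the norm, which
controls integrability. -/
theorem AnisotropicWeight.one_add_norm_le (x : EuclideanSpace ℝ (Fin n)) :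
    1 + ‖x‖ ≤ 2 * max 1 (M.size x) ^ M.total := by
  set T := max 1 (M.size x)
  have hT : 1 ≤ T := le_max_left _ _
  have hTt : 1 ≤ T ^ M.total := Real.one_le_rpow hT M.total_nonneg
  suffices h : ‖x‖ ≤ T ^ M.total by linarith
  by_cases h0 : x = 0
  · rw [h0, norm_zero]; positivity
  obtain ⟨hs, hsum⟩ := M.size_spec h0
  refine abs_le_of_sq_le_sq' ?_ (by positivity) |>.2
  rw [EuclideanSpace.real_norm_sq_eq]
  calc ∑ j, x j ^ 2 = ∑ j, (x j / M.size x ^ M.m j) ^ 2 * (M.size x ^ M.m j) ^ 2 := by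
        refine Finset.sum_congr rfl fun j _ => ?_
        have : M.size x ^ M.m j ≠ 0 := by positivity
        field_simp
    _ ≤ ∑ j, (x j / M.size x ^ M.m j) ^ 2 * (T ^ M.total) ^ 2 := by
        refine Finset.sum_le_sum fun j _ => ?_
        gcongr
        calc M.size x ^ M.m j ≤ T ^ M.m j :=
              Real.rpow_le_rpow hs.le (le_max_right _ _) (by linarith [M.one_le j])
          _ ≤ T ^ M.total := Real.rpow_le_rpow_of_exponent_le hT
              (Finset.single_le_sum (f := M.m) (fun i _ => by linarith [M.one_le i])
                (Finset.mem_univ j))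
    _ = (T ^ M.total) ^ 2 := by rw [← Finset.sum_mul, hsum, one_mul]

/-- The Triebel–Lizorkin norm of a sum of concentrated blocks. -/
theorem exists_spaceNorm_dilSum_triebel_le {A : SpaceParams} (hA : A.scale = Scale.F) {σ : ℝ}
    (hσ : |σ| = 1) {f : 𝓢(EuclideanSpace ℝ (Fin n), ℂ)}
    (hf : SpectrumIn f (M.patch 0 0 (3 * M.radius))) :
    ∃ C : ℝ≥0∞, C ≠ ⊤ ∧ ∀ J : Finset ℕ, J.Nonempty →
      spaceNorm M Ψ A (blockSum (A.s - M.total * A.recip) J (dilBlock M σ f)) ≤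
        (J.card : ℝ≥0∞) ^ A.recip * C := by
  have hp := A.p_lt_top hA
  set a := M.total * A.recip with ha
  -- Here `p < ∞` is essential: `a = |M|/p` is the growth rate of the weighted blocks before the
  -- peak.
  have ha0 : 0 < a := mul_pos M.total_pos
    (ENNReal.toReal_pos (ENNReal.inv_ne_zero.mpr hp.ne) (ENNReal.inv_ne_top.mpr A.p_pos.ne'))
  obtain ⟨B, hB⟩ := Measure.HasTemperateGrowth.exists_eLpNorm_lt_top (E := EuclideanSpace ℝ (Fin n))
    A.p (μ := volume) inferInstance
  -- `D ≥ a + 1` makes the terms fall at least by a factor 2 per step after the peak, while `D ≥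
  -- |M|B` makes the majorant `g` integrable to the power `p`.
  obtain ⟨D, hD1⟩ := exists_nat_ge (max (a + 1) (M.total * B))
  have hDa : a + 1 ≤ D := (le_max_left _ _).trans hD1
  have hDB : M.total * B ≤ D := (le_max_right _ _).trans hD1
  obtain ⟨C₁, hC₁⟩ : ∃ C, ∀ x, (1 + ‖x‖) ^ D * ‖f x‖ ≤ C :=
    ⟨_, fun x => by simpa using
      SchwartzMap.one_add_le_sup_seminorm_apply (𝕜 := ℂ) (m := (D, 0)) le_rfl le_rfl f x⟩
  have hC₁0 : 0 ≤ C₁ := le_trans (by positivity) (hC₁ 0)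
  -- A majorant depending only on `[y]`: along `2^{kM}x` it is 1 while `2^k[x] ≤ 1` and an exact
  -- power afterwards. Weighted by `2^{ak}` it is geometric on both sides.
  let g : EuclideanSpace ℝ (Fin n) → ℝ := fun y => (max 1 (M.size y) ^ D)⁻¹
  have hfg : ∀ y, ‖f y‖ ≤ C₁ * g y := by
    intro y
    have h1 : 0 < max 1 (M.size y) ^ D := by positivity
    rw [← div_eq_mul_inv, le_div_iff₀ h1, mul_comm]
    refine le_trans ?_ (hC₁ y)
    gcongr
    exact M.max_one_size_le y
  have hgG : ∀ y, g y ≤ 2 ^ B * (1 + ‖y‖) ^ (-(B : ℝ)) := by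
    intro y
    rw [Real.rpow_neg (by positivity), Real.rpow_natCast, ← div_eq_mul_inv,
      le_div_iff₀ (by positivity), inv_mul_le_iff₀ (by positivity)]
    calc (1 + ‖y‖) ^ B ≤ (2 * max 1 (M.size y) ^ M.total) ^ B := by
          gcongr; exact M.one_add_norm_le y
      _ = max 1 (M.size y) ^ (M.total * B) * 2 ^ B := by
          rw [mul_pow, mul_comm, ← Real.rpow_natCast (_ ^ M.total), ← Real.rpow_mul (by positivity)]
      _ ≤ max 1 (M.size y) ^ D * 2 ^ B := by
          rw [← Real.rpow_natCast _ D]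
          gcongr
          exact le_max_left _ _
  let G : EuclideanSpace ℝ (Fin n) → ℝ := fun y => (1 + ‖y‖) ^ (-(B : ℝ))
  have hG : Continuous G := (continuous_const.add continuous_norm).rpow_const
    fun y => Or.inl (by positivity : (0 : ℝ) < 1 + ‖y‖).ne'
  set ρ : ℝ≥0∞ := 2 ^ (-min a 1) with hρdef
  have hρ : ρ < 1 := ENNReal.rpow_lt_one_of_one_lt_of_neg (by norm_num) (by
    have : 0 < min a 1 := lt_min ha0 one_pos
    linarith)
  have hρpow : ∀ (i : ℕ) (t : ℝ), min a 1 ≤ t → (2 : ℝ≥0∞) ^ (-(t * i)) ≤ ρ ^ i := by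
    intro i t ht
    rw [hρdef, ← ENNReal.rpow_natCast, ← ENNReal.rpow_mul]
    refine ENNReal.rpow_le_rpow_of_exponent_le (by norm_num) ?_
    have : (0 : ℝ) ≤ i := by positivity
    nlinarith
  obtain ⟨C₂, hC₂, hpeak⟩ := exists_ellNorm_le_of_peak A.q_pos hρ
  set E : ℝ≥0∞ := C₂ * (ENNReal.ofReal C₁ * ENNReal.ofReal (2 ^ B)) with hE
  have hEtop : E ≠ ⊤ := ENNReal.mul_ne_top hC₂ (ENNReal.mul_ne_top (by simp) (by simp))
  refine ⟨E * eLpNorm G A.p volume, ENNReal.mul_ne_top hEtop hB.ne, fun J hJ => ?_⟩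
  rw [spaceNorm_of_triebel M Ψ hA, A.recip_eq]
  refine eLpNorm_le_of_forall_exists A.p_pos.ne' hp.ne
    (h := fun k x => E * 2 ^ (a * k) * ‖G (M.dyadicDilation k x)‖ₑ) (fun k _ => ?_) (fun k _ => ?_)
    (fun x => ?_)
  · exact (hG.comp (M.dyadicDilation k).continuous).enorm.measurable.const_mul _
  · rw [eLpNorm_const_mul_enorm (ENNReal.mul_ne_top hEtop (two_rpow_ne_top _))
      (fun x => G (M.dyadicDilation k x)), M.eLpNorm_comp_dyadicDilation, mul_assoc,
      ← mul_assoc ((2 : ℝ≥0∞) ^ (a * (k : ℝ))), two_rpow_mul]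
    refine le_of_eq ?_
    rw [show a * k + -(((k : ℤ) : ℝ) * M.total * (A.p⁻¹).toReal) = 0 by
      rw [ha, A.recip_eq]; push_cast; ring, ENNReal.rpow_zero, one_mul]
  · let b : ℕ → ℝ≥0∞ := fun k => 2 ^ (a * k) * ENNReal.ofReal (g (M.dyadicDilation k x))
    have hsize : ∀ k : ℕ, M.size (M.dyadicDilation k x) = 2 ^ k * M.size x := fun k => by
      rw [M.size_dyadicDilation, zpow_natCast]
    obtain ⟨k, hk, hle⟩ := hpeak b J (fun k => 2 ^ k * M.size x ≤ 1) hJ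
      (by
        intro k _ l _ hk hl hkl
        have h1 : ∀ i : ℕ, 2 ^ i * M.size x ≤ 1 → g (M.dyadicDilation i x) = 1 := fun i hi => by
          simp only [g, hsize, max_eq_left hi, one_pow, inv_one]
        simp only [b, h1 k hk, h1 l hl, ENNReal.ofReal_one, mul_one]
        calc (2 : ℝ≥0∞) ^ (a * k) = 2 ^ (-(a * (l - k : ℕ))) * 2 ^ (a * l) := by
              rw [two_rpow_mul, Nat.cast_sub hkl]
              congr 1
              ring
          _ ≤ _ := by
              gcongr
              exact hρpow _ _ (min_le_left _ _))
      (by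
        intro k _ l _ hk hl hlk
        push Not at hk hl
        have hS : 0 < M.size x := by
          by_contra! h
          have : (0 : ℝ) < 2 ^ l := by positivity
          nlinarith
        have h1 : ∀ i : ℕ, 1 < 2 ^ i * M.size x → b i =
            2 ^ ((a - D) * i) * ENNReal.ofReal ((M.size x ^ D)⁻¹) := fun i hi => by
          simp only [b, g, hsize, max_eq_right hi.le, mul_pow, mul_inv]
          rw [ENNReal.ofReal_mul (by positivity), ← mul_assoc]
          congr 1
          have h2 : ((2 : ℝ) ^ i) ^ D = 2 ^ ((D : ℝ) * i) := by
            rw [← pow_mul, ← Real.rpow_natCast, Nat.cast_mul, mul_comm]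
          rw [h2, ← Real.rpow_neg (by norm_num), ← ENNReal.ofReal_rpow_of_pos (by norm_num),
            ENNReal.ofReal_ofNat, two_rpow_mul]
          congr 1
          ring
        rw [h1 k hk, h1 l hl, ← mul_assoc]
        gcongr
        calc (2 : ℝ≥0∞) ^ ((a - D) * k) =
              2 ^ (-((D - a) * (k - l : ℕ))) * 2 ^ ((a - D) * l) := by
              rw [two_rpow_mul, Nat.cast_sub hlk]
              congr 1
              ring
          _ ≤ _ := by
              gcongr
              exact hρpow _ _ ((min_le_right _ _).trans (by linarith)))
    refine ⟨k, hk, ?_⟩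
    have hterm : ∀ j : ℕ, (2 : ℝ≥0∞) ^ (A.s * j) * ‖bandPart (Ψ.dyadicSchwartz M j)
        (blockSum (A.s - a) J (dilBlock M σ f) : 𝓢(EuclideanSpace ℝ (Fin n), ℂ)) x‖ₑ ≤
        ENNReal.ofReal C₁ * if j ∈ J then b j else 0 := by
      intro j
      rw [blockSum, bandPart_sum_core M Ψ fun k _ =>
        (spectrumIn_dilBlock_core M hσ hf k).const_smul _]
      split_ifs with hj
      · rw [smul_apply, enorm_smul, enorm_weightFactor, enorm_dilBlock, ← mul_assoc, two_rpow_mul,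
          show A.s * (j : ℝ) + -((A.s - a) * j) = a * j by ring]
        simp only [b]
        rw [mul_left_comm]
        gcongr
        rw [← ENNReal.ofReal_mul hC₁0, ← ofReal_norm]
        exact ENNReal.ofReal_le_ofReal (hfg _)
      · simp
    have hconst : ∀ c : ℝ≥0∞, ∀ d : ℕ → ℝ≥0∞,
        ellNorm A.q (fun j => c * d j) ≤ c * ellNorm A.q d := by
      intro c d
      unfold ellNorm
      split_ifs with hq
      · rw [ENNReal.mul_iSup]
      · have hq' : 0 < A.q.toReal := ENNReal.toReal_pos A.q_pos.ne' hq
        simp only [ENNReal.mul_rpow_of_nonneg _ _ hq'.le]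
        rw [ENNReal.tsum_mul_left, ENNReal.mul_rpow_of_nonneg _ _ (by positivity),
          ← ENNReal.rpow_mul, mul_one_div_cancel hq'.ne', ENNReal.rpow_one]
    calc _ ≤ ENNReal.ofReal C₁ * ellNorm A.q (fun j => if j ∈ J then b j else 0) :=
          (ellNorm_mono hterm).trans (hconst _ _)
      _ ≤ ENNReal.ofReal C₁ * (C₂ * b k) := by gcongr
      _ ≤ ENNReal.ofReal C₁ * (C₂ * (2 ^ (a * k) *
            (ENNReal.ofReal (2 ^ B) * ‖G (M.dyadicDilation k x)‖ₑ))) := by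
          simp only [b]
          gcongr
          rw [Real.enorm_of_nonneg (by positivity), ← ENNReal.ofReal_mul (by positivity)]
          exact ENNReal.ofReal_le_ofReal (hgG _)
      _ = _ := by rw [hE]; ring

end Triebel

end

noncomputable section

/-! ### The product estimate tested on blocks -/

section Necessity

variable {n : ℕ} {M : AnisotropicWeight n} {Ψ : DyadicCutoff} {A₀ A₁ A₂ : SpaceParams}

/-- The estimate `‖f g‖_{A₂} ≤ c ‖f‖_{A₀} ‖g‖_{A₁}` for Schwartz functions. -/
def MulBound (M : AnisotropicWeight n) (Ψ : DyadicCutoff) (A₀ A₁ A₂ : SpaceParams) : Prop :=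
  ∃ c : ℝ≥0, ∀ f g : 𝓢(EuclideanSpace ℝ (Fin n), ℂ),
    spaceNorm M Ψ A₂ (schwartzMul f g) ≤ c * spaceNorm M Ψ A₀ f * spaceNorm M Ψ A₁ g

theorem MulBound.symm (h : MulBound M Ψ A₀ A₁ A₂) : MulBound M Ψ A₁ A₀ A₂ := by
  obtain ⟨c, hc⟩ := h
  refine ⟨c, fun f g => ?_⟩
  rw [schwartzMul_comm, mul_right_comm]
  exact hc g f

/-- Only growth rates in a parameter `t → ∞` survive; constants are irrelevant provided they are
finite on the right and nonzero on the left. The parameter will be `2^k` or the number `N` of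
blocks. -/
theorem MulBound.exponent_le (h : MulBound M Ψ A₀ A₁ A₂) {t : ℕ → ℝ≥0∞}
    (ht : Tendsto t atTop (𝓝 ⊤)) (htop : ∀ N, t N ≠ ⊤)
    {f g : ℕ → 𝓢(EuclideanSpace ℝ (Fin n), ℂ)} {C₀ C₁ c : ℝ≥0∞} (hC₀ : C₀ ≠ ⊤) (hC₁ : C₁ ≠ ⊤)
    (hc : c ≠ 0) {α β γ : ℝ} (h₀ : ∀ᶠ N in atTop, spaceNorm M Ψ A₀ (f N) ≤ t N ^ α * C₀)
    (h₁ : ∀ᶠ N in atTop, spaceNorm M Ψ A₁ (g N) ≤ t N ^ β * C₁)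
    (h₂ : ∀ᶠ N in atTop, t N ^ γ * c ≤ spaceNorm M Ψ A₂ (schwartzMul (f N) (g N))) :
    γ ≤ α + β := by
  obtain ⟨K, hK⟩ := h
  refine exponent_le_of_tendsto_top ht htop hc (c₂ := K * C₀ * C₁)
    (ENNReal.mul_ne_top (ENNReal.mul_ne_top (by simp) hC₀) hC₁) ?_
  filter_upwards [h₀, h₁, h₂, ht.eventually_const_lt (by simp : (0 : ℝ≥0∞) < ⊤)]
    with N a0 a1 a2 hpos
  calc c * t N ^ γ = t N ^ γ * c := mul_comm _ _
    _ ≤ K * spaceNorm M Ψ A₀ (f N) * spaceNorm M Ψ A₁ (g N) := a2.trans (hK _ _)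
    _ ≤ K * (t N ^ α * C₀) * (t N ^ β * C₁) := by gcongr
    _ = _ := by
      rw [ENNReal.rpow_add _ _ hpos.ne' (htop N)]
      ring

theorem two_pow_rpow (N : ℕ) (a : ℝ) : ((2 : ℝ≥0∞) ^ N) ^ a = 2 ^ (a * N) := by
  rw [← ENNReal.rpow_natCast, ← ENNReal.rpow_mul, mul_comm]

/-- Comparison of exponents for test functions depending on a dyadic scale. -/
theorem MulBound.exponent_le_of_scale (h : MulBound M Ψ A₀ A₁ A₂)
    {f g : ℕ → 𝓢(EuclideanSpace ℝ (Fin n), ℂ)} {C₀ C₁ c : ℝ≥0∞} (hC₀ : C₀ ≠ ⊤) (hC₁ : C₁ ≠ ⊤)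
    (hc : c ≠ 0) {α β γ : ℝ} (h₀ : ∀ k, spaceNorm M Ψ A₀ (f k) = 2 ^ (α * k) * C₀)
    (h₁ : ∀ k, spaceNorm M Ψ A₁ (g k) = 2 ^ (β * k) * C₁)
    (h₂ : ∀ᶠ k : ℕ in atTop, 2 ^ (γ * k) * c ≤ spaceNorm M Ψ A₂ (schwartzMul (f k) (g k))) :
    γ ≤ α + β :=
  h.exponent_le (f := f) (g := g) tendsto_two_pow_ennreal (by simp) hC₀ hC₁ hc
    (Eventually.of_forall fun k => by rw [two_pow_rpow, h₀])
    (Eventually.of_forall fun k => by rw [two_pow_rpow, h₁])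
    (h₂.mono fun k hk => by rwa [two_pow_rpow])

/-- Comparison of exponents for test functions depending on a number of frequencies. -/
theorem MulBound.exponent_le_of_card (h : MulBound M Ψ A₀ A₁ A₂)
    {f g : ℕ → 𝓢(EuclideanSpace ℝ (Fin n), ℂ)} {C₀ C₁ c : ℝ≥0∞} (hC₀ : C₀ ≠ ⊤) (hC₁ : C₁ ≠ ⊤)
    (hc : c ≠ 0) {α β γ : ℝ} (h₀ : ∀ N : ℕ, N ≠ 0 → spaceNorm M Ψ A₀ (f N) ≤ N ^ α * C₀)
    (h₁ : ∀ N : ℕ, N ≠ 0 → spaceNorm M Ψ A₁ (g N) ≤ N ^ β * C₁)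
    (h₂ : ∀ N : ℕ, N ≠ 0 → (N : ℝ≥0∞) ^ γ * c ≤ spaceNorm M Ψ A₂ (schwartzMul (f N) (g N))) :
    γ ≤ α + β :=
  h.exponent_le (f := f) (g := g) tendsto_natCast_ennreal (by simp) hC₀ hC₁ hc
    ((eventually_ne_atTop 0).mono h₀) ((eventually_ne_atTop 0).mono h₁)
    ((eventually_ne_atTop 0).mono h₂)

/-! ### Spectra of products of blocks -/

theorem SpectrumIn.sum {ι : Type*} {J : Finset ι} {f : ι → 𝓢(EuclideanSpace ℝ (Fin n), ℂ)}
    {S : Set (EuclideanSpace ℝ (Fin n))} (h : ∀ i ∈ J, SpectrumIn (f i) S) :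
    SpectrumIn (∑ i ∈ J, f i) S := by
  intro η hη
  rw [FourierTransform.fourier_sum, sum_apply] at hη
  obtain ⟨i, hi, hne⟩ := Finset.exists_ne_zero_of_sum_ne_zero hη
  exact h i hi η hne

theorem SpectrumIn.mul_same {f g : 𝓢(EuclideanSpace ℝ (Fin n), ℂ)} {σ τ : ℝ} {k : ℤ}
    (hf : SpectrumIn f (M.patch σ k M.radius)) (hg : SpectrumIn g (M.patch τ k M.radius)) :
    SpectrumIn (_root_.schwartzMul f g) (M.patch (σ + τ) k (3 * M.radius)) :=
  (hf.schwartzMul hg).mono (M.patch_add_same.trans (M.patch_mono (by linarith [M.radius_pos])))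

theorem SpectrumIn.mul_low {f g : 𝓢(EuclideanSpace ℝ (Fin n), ℂ)} {σ : ℝ} (hσ : |σ| = 1) {k : ℕ}
    (hf : SpectrumIn f (M.patch σ k M.radius)) (hg : SpectrumIn g (M.patch 0 0 M.radius)) :
    SpectrumIn (_root_.schwartzMul f g) (M.core k) :=
  (hf.schwartzMul hg).mono (((M.patch_add_low (by omega)).trans
    (M.patch_mono (by linarith [M.radius_pos]))).trans (M.patch_subset_core hσ k))

theorem SpectrumIn.mul_far {f g : 𝓢(EuclideanSpace ℝ (Fin n), ℂ)} {σ τ : ℝ} (hσ : |σ| = 1)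
    (hτ : |τ| = 1) {k l L : ℕ} (hL : 2 ≤ M.radius * 2 ^ L) (hkl : l + L ≤ k)
    (hf : SpectrumIn f (M.patch σ k M.radius)) (hg : SpectrumIn g (M.patch τ l M.radius)) :
    SpectrumIn (_root_.schwartzMul f g) (M.core k) :=
  (hf.schwartzMul hg).mono ((M.patch_add_far hτ.le hL (by omega)).trans
    (M.patch_subset_core hσ k))

/-- In a product of lacunary sums the off-diagonal terms keep the larger of the two frequencies. -/
theorem bandPart_mul_blockSum {F G : ℕ → 𝓢(EuclideanSpace ℝ (Fin n), ℂ)} {σ τ : ℝ}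
    (hσ : |σ| = 1) (hτ : |τ| = 1) (hF : ∀ k : ℕ, SpectrumIn (F k) (M.patch σ k M.radius))
    (hG : ∀ k : ℕ, SpectrumIn (G k) (M.patch τ k M.radius)) {L : ℕ} (hL : 2 ≤ M.radius * 2 ^ L)
    {J : Finset ℕ} (hJ : Sparse L J) (s t : ℝ) {j : ℕ} (hj : j ∉ J)
    (x : EuclideanSpace ℝ (Fin n)) :
    bandPart (Ψ.dyadicSchwartz M j) (schwartzMul (blockSum s J F) (blockSum t J G)) x =
      ∑ k ∈ J, weightFactor (s + t) k *
        bandPart (Ψ.dyadicSchwartz M j) (schwartzMul (F k) (G k)) x := by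
  rw [schwartzMul_blockSum_blockSum, bandPart_sum, Finset.sum_product]
  refine Finset.sum_congr rfl fun k hk => ?_
  rw [Finset.sum_eq_single_of_mem k hk, bandPart_smul, weightFactor_mul]
  intro l hl hlk
  rw [bandPart_smul]
  rcases hJ k hk l hl (Ne.symm hlk) with h | h
  · rw [schwartzMul_comm, bandPart_of_core M Ψ (SpectrumIn.mul_far hτ hσ hL h (hG l) (hF k)),
      if_neg (by rintro rfl; exact hj hl), mul_zero]
  · rw [bandPart_of_core M Ψ (SpectrumIn.mul_far hσ hτ hL h (hF k) (hG l)),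
      if_neg (by rintro rfl; exact hj hk), mul_zero]

variable {f : 𝓢(EuclideanSpace ℝ (Fin n), ℂ)}

theorem schwartzMul_modBlock_neg (f : 𝓢(EuclideanSpace ℝ (Fin n), ℂ)) (k : ℕ) :
    schwartzMul (modBlock M 1 f k) (modBlock M (-1) f k) = schwartzMul f f := by
  rw [modBlock, modBlock, schwartzMul_waveMul, ← add_smul, neg_mul, add_neg_cancel, zero_smul,
    waveMul_zero]

theorem schwartzMul_modBlock (f g : 𝓢(EuclideanSpace ℝ (Fin n), ℂ)) (σ : ℝ) (k : ℕ) :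
    schwartzMul (modBlock M σ f k) g = modBlock M σ (schwartzMul f g) k := by
  conv_lhs => rw [← waveMul_zero g]
  rw [modBlock, modBlock, schwartzMul_waveMul, add_zero]

theorem schwartzMul_dilBlock (f : 𝓢(EuclideanSpace ℝ (Fin n), ℂ)) (σ τ : ℝ) (k : ℕ) :
    schwartzMul (dilBlock M σ f k) (dilBlock M τ f k) =
      dilBlock M (σ + τ) (schwartzMul f f) k := by
  rw [dilBlock, dilBlock, dilBlock, schwartzMul_dilate, schwartzMul_waveMul, add_smul]

theorem dilBlock_zero (f : 𝓢(EuclideanSpace ℝ (Fin n), ℂ)) (k : ℕ) :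
    dilBlock M 0 f k = dilate M k f := by
  rw [dilBlock, zero_smul, waveMul_zero]

theorem spectrum_wide (hf : SpectrumIn f (M.patch 0 0 M.radius)) :
    SpectrumIn f (M.patch 0 0 (3 * M.radius)) :=
  hf.mono (M.patch_mono (by linarith [M.radius_pos]))

theorem spectrum_sq (hf : SpectrumIn f (M.patch 0 0 M.radius)) :
    SpectrumIn (schwartzMul f f) (M.patch 0 0 (3 * M.radius)) := by
  simpa using hf.mul_same hf

theorem spaceNorm_low (A : SpaceParams) (hf : SpectrumIn f (M.patch 0 0 (3 * M.radius))) :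
    spaceNorm M Ψ A f = eLpNorm f A.p volume := by
  rw [spaceNorm_of_core M Ψ A (hf.mono (M.patch_zero_subset_core le_rfl))]
  simp

theorem spaceNorm_modBlock (A : SpaceParams) {σ : ℝ} (hσ : |σ| = 1)
    (hf : SpectrumIn f (M.patch 0 0 (3 * M.radius))) (k : ℕ) :
    spaceNorm M Ψ A (modBlock M σ f k) = (2 : ℝ≥0∞) ^ (A.s * k) * eLpNorm f A.p volume := by
  rw [spaceNorm_of_core M Ψ A ((spectrumIn_modBlock M hf k).mono (M.patch_subset_core hσ k))]
  congr 1
  exact eLpNorm_congr_enorm_ae (Eventually.of_forall fun x => enorm_modBlock M _ _ _ _)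

theorem eLpNorm_sq_ne_zero (h0 : f 0 ≠ 0) {p : ℝ≥0∞} (hp : p ≠ 0) :
    eLpNorm (schwartzMul f f) p volume ≠ 0 :=
  eLpNorm_ne_zero (x₀ := 0) (by rw [schwartzMul_apply]; exact mul_ne_zero h0 h0) hp

theorem eLpNorm_schwartz_ne_top (f : 𝓢(EuclideanSpace ℝ (Fin n), ℂ)) (p : ℝ≥0∞) :
    eLpNorm f p volume ≠ ⊤ :=
  (f.eLpNorm_lt_top p volume).ne

theorem one_notMem_of_one_le {J : Finset ℕ} (hJ : ∀ k ∈ J, 1 ≤ k) : 0 ∉ J :=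
  fun h => absurd (hJ 0 h) (by omega)

/-! ### The necessary conditions -/

/-- Opposite modulations cancel: the product is `f²` for every `k`, while the factors have norms of
order `2^{s₀k}` and `2^{s₁k}`. -/
theorem MulBound.zero_le_add (h : MulBound M Ψ A₀ A₁ A₂) : 0 ≤ A₀.s + A₁.s := by
  obtain ⟨f, hf, h0, -⟩ := exists_base M
  refine h.exponent_le_of_scale (f := modBlock M 1 f) (g := modBlock M (-1) f)
    (eLpNorm_schwartz_ne_top f A₀.p) (eLpNorm_schwartz_ne_top f A₁.p) (eLpNorm_sq_ne_zero h0 A₂.p_pos.ne')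
    (fun k => spaceNorm_modBlock A₀ (by simp) (spectrum_wide hf) k)
    (fun k => spaceNorm_modBlock A₁ (by simp) (spectrum_wide hf) k)
    (Eventually.of_forall fun k => ?_)
  rw [schwartzMul_modBlock_neg, spaceNorm_low A₂ (spectrum_sq hf)]
  simp

/-- With `s₀ + s₁ = 0` the weights on the diagonal are 1, so band 0 of the product is exactly `N
f²`. The factors have norms of order `N^{1/q₀}` and `N^{1/q₁}`. -/
theorem MulBound.one_le_of_add_eq_zero (h : MulBound M Ψ A₀ A₁ A₂) (hs : A₀.s + A₁.s = 0) :
    1 ≤ (A₀.q⁻¹).toReal + (A₁.q⁻¹).toReal := by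
  obtain ⟨f, hf, h0, -⟩ := exists_base M
  obtain ⟨L, hL2, hL⟩ := M.exists_gap
  choose J hcard hsparse hJ1 using exists_sparse L (by omega) 1
  have hne : ∀ N, N ≠ 0 → (J N).Nonempty := fun N hN => by
    rw [← Finset.card_pos, hcard]; omega
  refine h.exponent_le_of_card (f := fun N => blockSum A₀.s (J N) (modBlock M 1 f))
    (g := fun N => blockSum A₁.s (J N) (modBlock M (-1) f))
    (eLpNorm_schwartz_ne_top f A₀.p) (eLpNorm_schwartz_ne_top f A₁.p) (eLpNorm_sq_ne_zero h0 A₂.p_pos.ne')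
    (fun N hN => ?_) (fun N hN => ?_) (fun N hN => ?_)
  · rw [spaceNorm_modSum M Ψ A₀ (by simp) (hne N hN) (spectrum_wide hf), hcard]
  · rw [spaceNorm_modSum M Ψ A₁ (by simp) (hne N hN) (spectrum_wide hf), hcard]
  · refine le_trans (le_of_eq ?_) (le_spaceNorm M Ψ A₂ _ 0)
    have hb : bandPart (Ψ.dyadicSchwartz M 0) (schwartzMul (blockSum A₀.s (J N) (modBlock M 1 f))
        (blockSum A₁.s (J N) (modBlock M (-1) f))) = (N : ℂ) • ⇑(schwartzMul f f) := by
      ext x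
      rw [bandPart_mul_blockSum (by simp) (by simp) (spectrumIn_modBlock M hf)
        (spectrumIn_modBlock M hf) hL (hsparse N) _ _ (one_notMem_of_one_le (hJ1 N)), hs]
      simp only [schwartzMul_modBlock_neg, weightFactor_zero, one_mul]
      rw [bandPart_of_core M Ψ ((spectrum_sq hf).mono (M.patch_zero_subset_core le_rfl)),
        if_pos rfl, Finset.sum_const, hcard, nsmul_eq_mul, Pi.smul_apply, smul_eq_mul]
    rw [hb, eLpNorm_const_smul]
    simp [← ofReal_norm]

/-- Multiplication by the fixed low-frequency function `f` leaves a modulated block in its band. -/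
theorem MulBound.smoothness_le (h : MulBound M Ψ A₀ A₁ A₂) : A₂.s ≤ A₀.s := by
  obtain ⟨f, hf, h0, -⟩ := exists_base M
  have key := h.exponent_le_of_scale (f := modBlock M 1 f) (g := fun _ => f) (β := 0) (γ := A₂.s)
    (eLpNorm_schwartz_ne_top f A₀.p) (eLpNorm_schwartz_ne_top f A₁.p) (eLpNorm_sq_ne_zero h0 A₂.p_pos.ne')
    (fun k => spaceNorm_modBlock A₀ (by simp) (spectrum_wide hf) k)
    (fun k => by rw [spaceNorm_low A₁ (spectrum_wide hf)]; simp)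
    (Eventually.of_forall fun k => ?_)
  · simpa using key
  · rw [schwartzMul_modBlock, spaceNorm_modBlock A₂ (by simp) (spectrum_sq hf)]

theorem MulBound.inv_sum_exponent_le (h : MulBound M Ψ A₀ A₁ A₂) (hs : A₂.s = A₀.s) :
    (A₂.q⁻¹).toReal ≤ (A₀.q⁻¹).toReal := by
  obtain ⟨f, hf, h0, -⟩ := exists_base M
  choose J hcard _ _ using exists_sparse 1 (by omega) 1
  have hne : ∀ N, N ≠ 0 → (J N).Nonempty := fun N hN => by
    rw [← Finset.card_pos, hcard]; omega
  have key := h.exponent_le_of_card (f := fun N => blockSum A₀.s (J N) (modBlock M 1 f))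
    (g := fun _ => f) (α := (A₀.q⁻¹).toReal) (β := 0) (γ := (A₂.q⁻¹).toReal)
    (eLpNorm_schwartz_ne_top f A₀.p) (eLpNorm_schwartz_ne_top f A₁.p) (eLpNorm_sq_ne_zero h0 A₂.p_pos.ne')
    (fun N hN => ?_) (fun N hN => ?_) (fun N hN => ?_)
  · simpa using key
  · rw [spaceNorm_modSum M Ψ A₀ (by simp) (hne N hN) (spectrum_wide hf), hcard]
  · rw [spaceNorm_low A₁ (spectrum_wide hf)]
    simp
  · rw [schwartzMul_blockSum_left]
    simp only [schwartzMul_modBlock]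
    rw [← hs, spaceNorm_modSum M Ψ A₂ (by simp) (hne N hN) (spectrum_sq hf), hcard]

/-- Spreading `f` out by `2^{-kM}` keeps everything in band 0, so smoothness plays no role and only
the `L_p` scaling `2^{k|M|/p}` remains. -/
theorem MulBound.recip_le (h : MulBound M Ψ A₀ A₁ A₂) : A₂.recip ≤ A₀.recip + A₁.recip := by
  obtain ⟨f, hf, h0, -⟩ := exists_base M
  have hspec : ∀ {u : 𝓢(EuclideanSpace ℝ (Fin n), ℂ)} (_ : SpectrumIn u (M.patch 0 0 (3 * M.radius)))
      (k : ℕ), SpectrumIn (dilate M (-k) u) (M.core 0) := by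
    intro u hu k
    refine (hu.dilate M (-k) (T := M.patch 0 (-k) (3 * M.radius)) ?_).mono
      (M.patch_zero_subset_core (by omega))
    rintro _ ⟨y, hy, rfl⟩
    exact ⟨y, hy, by simp [M.dyadicDilation_zero]⟩
  have hnorm : ∀ (A : SpaceParams) {u : 𝓢(EuclideanSpace ℝ (Fin n), ℂ)}
      (_ : SpectrumIn u (M.patch 0 0 (3 * M.radius))) (k : ℕ),
      spaceNorm M Ψ A (dilate M (-k) u) =
        2 ^ (M.total * A.recip * k) * eLpNorm u A.p volume := by
    intro A u hu k
    rw [spaceNorm_of_core M Ψ A (hspec hu k), eLpNorm_dilate, A.recip_eq]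
    push_cast
    rw [mul_zero, ENNReal.rpow_zero, one_mul]
    congr 2
    ring
  have key := h.exponent_le_of_scale (f := fun k => dilate M (-k) f) (g := fun k => dilate M (-k) f)
    (γ := M.total * A₂.recip)
    (eLpNorm_schwartz_ne_top f A₀.p) (eLpNorm_schwartz_ne_top f A₁.p) (eLpNorm_sq_ne_zero h0 A₂.p_pos.ne')
    (hnorm A₀ (spectrum_wide hf)) (hnorm A₁ (spectrum_wide hf)) (Eventually.of_forall fun k => by
      rw [schwartzMul_dilate, hnorm A₂ (spectrum_sq hf)])
  rw [← mul_add] at key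
  exact le_of_mul_le_mul_left key M.total_pos

/-- A block concentrating at the origin sees `f` essentially as the nonzero constant `f(0)`, so the
product scales like the block itself. -/
theorem MulBound.differentialDimension_le (h : MulBound M Ψ A₀ A₁ A₂) :
    A₂.s - M.total * A₂.recip ≤ A₁.s - M.total * A₁.recip := by
  obtain ⟨f, hf, h0, -⟩ := exists_base M
  have hc : ‖f 0‖ₑ / 2 * eLpNorm ((Metric.ball 0 1).indicator f) A₂.p volume ≠ 0 :=
    mul_ne_zero (ENNReal.div_ne_zero.mpr ⟨by simpa using h0, by simp⟩)
      (eLpNorm_indicator_ne_zero f.continuous h0 Metric.isOpen_ball (by simp) A₂.p_pos.ne')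
  have key := h.exponent_le_of_scale (f := fun _ => f) (g := dilBlock M 1 f) (α := 0)
    (γ := A₂.s - M.total * A₂.recip)
    (eLpNorm_schwartz_ne_top f A₀.p) (eLpNorm_schwartz_ne_top f A₁.p) hc
    (fun k => by rw [spaceNorm_low A₀ (spectrum_wide hf)]; simp)
    (fun k => spaceNorm_dilBlock M Ψ A₁ (by simp) (spectrum_wide hf) k) ?_
  · simpa using key
  filter_upwards [eventually_le_eLpNorm_mul_dilBlock M (f := f) h0 1 A₂.p] with k hk
  have hspec : SpectrumIn (schwartzMul f (dilBlock M 1 f k)) (M.core k) := by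
    rw [schwartzMul_comm]
    exact (spectrumIn_dilBlock M hf k).mul_low (by simp) hf
  rw [spaceNorm_of_core M Ψ A₂ hspec]
  refine le_trans (le_of_eq ?_) (mul_le_mul_right hk _)
  rw [mul_left_comm (‖f 0‖ₑ / 2), ← mul_assoc ((2 : ℝ≥0∞) ^ (A₂.s * (k : ℝ))), two_rpow_mul,
    A₂.recip_eq]
  congr 2
  ring

theorem MulBound.inv_sum_exponent_le_of_besov (h : MulBound M Ψ A₀ A₁ A₂)
    (hs : A₂.s - M.total * A₂.recip = A₁.s - M.total * A₁.recip) (hB₁ : A₁.scale = Scale.B)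
    (hB₂ : A₂.scale = Scale.B) : (A₂.q⁻¹).toReal ≤ (A₁.q⁻¹).toReal := by
  obtain ⟨f, hf, h0, -⟩ := exists_base M
  have hc : ‖f 0‖ₑ / 2 * eLpNorm ((Metric.ball 0 1).indicator f) A₂.p volume ≠ 0 :=
    mul_ne_zero (ENNReal.div_ne_zero.mpr ⟨by simpa using h0, by simp⟩)
      (eLpNorm_indicator_ne_zero f.continuous h0 Metric.isOpen_ball (by simp) A₂.p_pos.ne')
  obtain ⟨K, hK⟩ := eventually_atTop.mp (eventually_le_eLpNorm_mul_dilBlock M (f := f) h0 1 A₂.p)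
  choose J hcard _ hJK using exists_sparse 1 (by omega) K
  have hne : ∀ N, N ≠ 0 → (J N).Nonempty := fun N hN => by
    rw [← Finset.card_pos, hcard]; omega
  have key := h.symm.exponent_le_of_card
    (f := fun N => blockSum (A₁.s - M.total * A₁.recip) (J N) (dilBlock M 1 f))
    (g := fun _ => f) (α := (A₁.q⁻¹).toReal) (β := 0) (γ := (A₂.q⁻¹).toReal)
    (eLpNorm_schwartz_ne_top f A₁.p) (eLpNorm_schwartz_ne_top f A₀.p) hc
    (fun N hN => ?_) (fun N hN => ?_) (fun N hN => ?_)
  · simpa using key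
  · rw [spaceNorm_dilSum_besov M Ψ hB₁ (by simp) (hne N hN) (spectrum_wide hf), hcard]
  · rw [spaceNorm_low A₀ (spectrum_wide hf)]
    simp
  · rw [schwartzMul_blockSum_left]
    nth_rw 1 [← hcard N]
    refine le_spaceNorm_of_besov M Ψ hB₂ (hne N hN) fun k hk => ?_
    have hb : bandPart (Ψ.dyadicSchwartz M k) (blockSum (A₁.s - M.total * A₁.recip) (J N)
        fun k => schwartzMul (dilBlock M 1 f k) f) =
        weightFactor (A₁.s - M.total * A₁.recip) k • ⇑(schwartzMul f (dilBlock M 1 f k)) := by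
      ext x
      rw [blockSum, bandPart_sum_core M Ψ fun l _ =>
        ((spectrumIn_dilBlock M hf l).mul_low (by simp) hf).const_smul _, if_pos hk,
        schwartzMul_comm]
      rfl
    rw [hb, eLpNorm_const_smul, enorm_weightFactor, ← hs, ← mul_assoc, two_rpow_mul]
    refine le_trans (le_of_eq ?_) (mul_le_mul_right (hK k (hJK N k hk)) _)
    rw [mul_left_comm (‖f 0‖ₑ / 2), ← mul_assoc, two_rpow_mul, A₂.recip_eq]
    convert (one_mul _).symm
    convert ENNReal.rpow_zero
    ring

theorem spectrum_dilBlock_two (hf : SpectrumIn f (M.patch 0 0 (3 * M.radius))) (k : ℕ) :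
    SpectrumIn (dilBlock M 2 f k) (M.core (k + 1)) :=
  (spectrumIn_dilBlock M hf k).mono
    ((M.patch_two_subset k).trans (M.patch_subset_core (by simp) (k + 1)))

/-- The square of a concentrated block is again a concentrated block, with `f²` in place of `f` and
frequency `2e`, hence one band higher; the shift accounts for the constant `2^{s₂}`. -/
theorem MulBound.differentialDimension_le_add (h : MulBound M Ψ A₀ A₁ A₂) :
    A₂.s - M.total * A₂.recip ≤
      (A₀.s - M.total * A₀.recip) + (A₁.s - M.total * A₁.recip) := by
  obtain ⟨f, hf, h0, -⟩ := exists_base M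
  refine h.exponent_le_of_scale (f := dilBlock M 1 f) (g := dilBlock M 1 f)
    (c := 2 ^ A₂.s * eLpNorm (schwartzMul f f) A₂.p volume)
    (eLpNorm_schwartz_ne_top f A₀.p) (eLpNorm_schwartz_ne_top f A₁.p)
    (mul_ne_zero (two_rpow_ne_zero _) (eLpNorm_sq_ne_zero h0 A₂.p_pos.ne'))
    (fun k => spaceNorm_dilBlock M Ψ A₀ (by simp) (spectrum_wide hf) k)
    (fun k => spaceNorm_dilBlock M Ψ A₁ (by simp) (spectrum_wide hf) k)
    (Eventually.of_forall fun k => le_of_eq ?_)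
  rw [schwartzMul_dilBlock, one_add_one_eq_two,
    spaceNorm_of_core M Ψ A₂ (spectrum_dilBlock_two (spectrum_sq hf) k), eLpNorm_dilBlock,
    ← mul_assoc, ← mul_assoc, two_rpow_mul, two_rpow_mul, A₂.recip_eq]
  congr 2
  push_cast
  ring

theorem MulBound.inv_sum_exponent_le_add (h : MulBound M Ψ A₀ A₁ A₂)
    (hs : A₂.s - M.total * A₂.recip =
      (A₀.s - M.total * A₀.recip) + (A₁.s - M.total * A₁.recip))
    (hB₀ : A₀.scale = Scale.B) (hB₁ : A₁.scale = Scale.B) (hB₂ : A₂.scale = Scale.B) :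
    (A₂.q⁻¹).toReal ≤ (A₀.q⁻¹).toReal + (A₁.q⁻¹).toReal := by
  obtain ⟨f, hf, h0, -⟩ := exists_base M
  obtain ⟨L, hL2, hL⟩ := M.exists_gap
  choose J hcard hsparse _ using exists_sparse L (by omega) 1
  have hne : ∀ N, N ≠ 0 → (J N).Nonempty := fun N hN => by
    rw [← Finset.card_pos, hcard]; omega
  refine h.exponent_le_of_card
    (f := fun N => blockSum (A₀.s - M.total * A₀.recip) (J N) (dilBlock M 1 f))
    (g := fun N => blockSum (A₁.s - M.total * A₁.recip) (J N) (dilBlock M 1 f))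
    (c := 2 ^ A₂.s * eLpNorm (schwartzMul f f) A₂.p volume)
    (eLpNorm_schwartz_ne_top f A₀.p) (eLpNorm_schwartz_ne_top f A₁.p)
    (mul_ne_zero (two_rpow_ne_zero _) (eLpNorm_sq_ne_zero h0 A₂.p_pos.ne'))
    (fun N hN => ?_) (fun N hN => ?_) (fun N hN => ?_)
  · rw [spaceNorm_dilSum_besov M Ψ hB₀ (by simp) (hne N hN) (spectrum_wide hf), hcard]
  · rw [spaceNorm_dilSum_besov M Ψ hB₁ (by simp) (hne N hN) (spectrum_wide hf), hcard]
  -- The squares occupy the shifted set `J + 1`, which is disjoint from `J` by the gap. The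
  -- off-diagonal terms, lying in bands of `J`, do not interfere there.
  · have hcard' : ((J N).image (· + 1)).card = N := by
      rw [Finset.card_image_of_injective _ (add_left_injective 1), hcard]
    nth_rw 1 [← hcard']
    refine le_spaceNorm_of_besov M Ψ hB₂ ((hne N hN).image _) fun j hj => le_of_eq ?_
    obtain ⟨k, hk, rfl⟩ := Finset.mem_image.mp hj
    have hnot : k + 1 ∉ J N := fun hk1 => by
      have := hsparse N k hk (k + 1) hk1 (by omega)
      omega
    have hb : bandPart (Ψ.dyadicSchwartz M (k + 1))
        (schwartzMul (blockSum (A₀.s - M.total * A₀.recip) (J N) (dilBlock M 1 f))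
          (blockSum (A₁.s - M.total * A₁.recip) (J N) (dilBlock M 1 f))) =
        weightFactor (A₂.s - M.total * A₂.recip) k • ⇑(dilBlock M 2 (schwartzMul f f) k) := by
      ext x
      rw [bandPart_mul_blockSum (by simp) (by simp) (spectrumIn_dilBlock M hf)
        (spectrumIn_dilBlock M hf) hL (hsparse N) _ _ hnot, ← hs]
      simp only [schwartzMul_dilBlock, one_add_one_eq_two,
        bandPart_of_core M Ψ (spectrum_dilBlock_two (spectrum_sq hf) _), add_left_inj, mul_ite,
        mul_zero]
      rw [Finset.sum_ite_eq, if_pos hk]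
      rfl
    rw [hb, eLpNorm_const_smul, enorm_weightFactor, eLpNorm_dilBlock,
      ← mul_assoc, ← mul_assoc, two_rpow_mul, two_rpow_mul, A₂.recip_eq]
    congr 2
    push_cast
    ring

/-- The product of oppositely modulated concentrated blocks is `f²` dilated by `2^{kM}`. Its
transform at low frequencies is close to `2^{-k|M|}` times the nonzero value at 0 of the transform
of `f²`, which bounds band 0 from below. -/
theorem MulBound.neg_total_le (h : MulBound M Ψ A₀ A₁ A₂) :
    -M.total ≤ (A₀.s - M.total * A₀.recip) + (A₁.s - M.total * A₁.recip) := by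
  obtain ⟨f, hf, -, h1⟩ := exists_base M
  obtain ⟨c, hc, K, hK⟩ := exists_le_eLpNorm_bandPart_dilates M Ψ h1 A₂.p_pos.ne'
  refine h.exponent_le_of_scale (f := dilBlock M 1 f) (g := dilBlock M (-1) f)
    (eLpNorm_schwartz_ne_top f A₀.p) (eLpNorm_schwartz_ne_top f A₁.p) hc
    (fun k => spaceNorm_dilBlock M Ψ A₀ (by simp) (spectrum_wide hf) k)
    (fun k => spaceNorm_dilBlock M Ψ A₁ (by simp) (spectrum_wide hf) k) ?_
  filter_upwards [eventually_ge_atTop K] with k hk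
  rw [schwartzMul_dilBlock, add_neg_cancel, dilBlock_zero]
  refine le_trans ?_ (le_spaceNorm M Ψ A₂ _ 0)
  have h2 := hK {k} (by simpa using hk)
  simp only [Finset.card_singleton, Nat.cast_one, one_mul, Finset.sum_singleton] at h2
  have h3 : ∀ u : EuclideanSpace ℝ (Fin n) → ℂ,
      eLpNorm (fun x => ((2 : ℝ) ^ (k * M.total) : ℝ) * u x) A₂.p volume =
        2 ^ (M.total * k) * eLpNorm u A₂.p volume := by
    intro u
    have h4 := enorm_weightFactor (-M.total) k
    have h5 : weightFactor (-M.total) k = ((2 : ℝ) ^ (k * M.total) : ℝ) := by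
      rw [weightFactor]
      congr 2
      ring
    rw [neg_mul, neg_neg] at h4
    rw [← h4, ← h5]
    exact eLpNorm_const_smul (weightFactor (-M.total) k) u A₂.p volume
  rw [h3] at h2
  calc (2 : ℝ≥0∞) ^ (-M.total * k) * c
      ≤ 2 ^ (-M.total * k) * (2 ^ (M.total * k) * eLpNorm (bandPart (Ψ.dyadicSchwartz M 0)
          (dilate M k (schwartzMul f f))) A₂.p volume) := by gcongr
    _ = _ := by
      rw [← mul_assoc, two_rpow_mul, neg_mul, neg_add_cancel]
      simp

/-- The common part of the two borderline cases on the line `s₀ + s₁ = |M|(1/p₀ + 1/p₁ - 1)`. -/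
theorem MulBound.one_le_of_sum_bounds (h : MulBound M Ψ A₀ A₁ A₂)
    (hs : (A₀.s - M.total * A₀.recip) + (A₁.s - M.total * A₁.recip) = -M.total) {α β : ℝ}
    (h₀ : ∀ f : 𝓢(EuclideanSpace ℝ (Fin n), ℂ), SpectrumIn f (M.patch 0 0 (3 * M.radius)) →
      ∃ C : ℝ≥0∞, C ≠ ⊤ ∧ ∀ J : Finset ℕ, J.Nonempty → spaceNorm M Ψ A₀
        (blockSum (A₀.s - M.total * A₀.recip) J (dilBlock M 1 f)) ≤ (J.card : ℝ≥0∞) ^ α * C)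
    (h₁ : ∀ f : 𝓢(EuclideanSpace ℝ (Fin n), ℂ), SpectrumIn f (M.patch 0 0 (3 * M.radius)) →
      ∃ C : ℝ≥0∞, C ≠ ⊤ ∧ ∀ J : Finset ℕ, J.Nonempty → spaceNorm M Ψ A₁
        (blockSum (A₁.s - M.total * A₁.recip) J (dilBlock M (-1) f)) ≤ (J.card : ℝ≥0∞) ^ β * C) :
    1 ≤ α + β := by
  obtain ⟨f, hf, -, h1⟩ := exists_base M
  obtain ⟨c, hc, K, hK⟩ := exists_le_eLpNorm_bandPart_dilates M Ψ h1 A₂.p_pos.ne'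
  obtain ⟨L, hL2, hL⟩ := M.exists_gap
  obtain ⟨C₀, hC₀, hb₀⟩ := h₀ f (spectrum_wide hf)
  obtain ⟨C₁, hC₁, hb₁⟩ := h₁ f (spectrum_wide hf)
  choose J hcard hsparse hJK using exists_sparse L (by omega) (max 1 K)
  have hne : ∀ N, N ≠ 0 → (J N).Nonempty := fun N hN => by
    rw [← Finset.card_pos, hcard]; omega
  refine h.exponent_le_of_card
    (f := fun N => blockSum (A₀.s - M.total * A₀.recip) (J N) (dilBlock M 1 f))
    (g := fun N => blockSum (A₁.s - M.total * A₁.recip) (J N) (dilBlock M (-1) f))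
    hC₀ hC₁ hc (fun N hN => by simpa only [hcard] using hb₀ (J N) (hne N hN))
    (fun N hN => by simpa only [hcard] using hb₁ (J N) (hne N hN)) (fun N hN => ?_)
  refine le_trans ?_ (le_spaceNorm M Ψ A₂ _ 0)
  have h2 := hK (J N) fun k hk => (le_max_right 1 K).trans (hJK N k hk)
  rw [hcard] at h2
  rw [Nat.cast_zero, mul_zero, ENNReal.rpow_zero, one_mul, ENNReal.rpow_one]
  refine h2.trans (le_of_eq (congrArg (fun u => eLpNorm u A₂.p volume) (funext fun x => ?_)))
  rw [bandPart_mul_blockSum (by simp) (by simp) (spectrumIn_dilBlock M hf)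
    (spectrumIn_dilBlock M hf) hL (hsparse N) _ _
    (one_notMem_of_one_le fun k hk => (le_max_left 1 K).trans (hJK N k hk)), hs]
  refine Finset.sum_congr rfl fun k _ => ?_
  rw [schwartzMul_dilBlock, add_neg_cancel, dilBlock_zero, weightFactor]
  congr 3
  ring

/-- The common part of the two borderline cases with `s₀ = |M|/p₀`. -/
theorem MulBound.one_le_of_sum_bound (h : MulBound M Ψ A₀ A₁ A₂)
    (hs : A₂.s - M.total * A₂.recip = A₁.s - M.total * A₁.recip) {α : ℝ}
    (h₀ : ∀ f : 𝓢(EuclideanSpace ℝ (Fin n), ℂ), SpectrumIn f (M.patch 0 0 (3 * M.radius)) →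
      ∃ C : ℝ≥0∞, C ≠ ⊤ ∧ ∀ J : Finset ℕ, J.Nonempty → spaceNorm M Ψ A₀
        (blockSum 0 J (dilBlock M 1 f)) ≤ (J.card : ℝ≥0∞) ^ α * C) :
    1 ≤ α := by
  obtain ⟨f, hf, h0, -⟩ := exists_base M
  obtain ⟨L, hL2, hL⟩ := M.exists_gap
  obtain ⟨C₀, hC₀, hb₀⟩ := h₀ f (spectrum_wide hf)
  have hc : ‖f 0‖ₑ / 2 * eLpNorm ((Metric.ball 0 1).indicator f) A₂.p volume ≠ 0 :=
    mul_ne_zero (ENNReal.div_ne_zero.mpr ⟨by simpa using h0, by simp⟩)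
      (eLpNorm_indicator_ne_zero f.continuous h0 Metric.isOpen_ball (by simp) A₂.p_pos.ne')
  let u : ℕ → 𝓢(EuclideanSpace ℝ (Fin n), ℂ) := fun N =>
    blockSum 0 (Finset.range N) (dilBlock M 1 f)
  -- All blocks carry weight 1 and take the value `f(0)` at the origin, so they add without
  -- cancellation there.
  have hu : ∀ N, u N 0 = N * f 0 := by
    intro N
    simp [u, blockSum, sum_apply, weightFactor_zero, dilBlock, dilate_apply,
      waveMul_apply]
  -- How strongly the second factor must concentrate depends on `u N`, so its frequency is chosen
  -- after `N`. The condition `N + L ≤ k` also puts it far above all frequencies of `u N`, so the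
  -- product stays in one band.
  have hex : ∀ N : ℕ, ∃ k, N + L ≤ k ∧ (N ≠ 0 → ‖u N 0‖ₑ / 2 *
      ((2 : ℝ≥0∞) ^ (-(k * M.total * (A₂.p⁻¹).toReal)) *
        eLpNorm ((Metric.ball 0 1).indicator f) A₂.p volume) ≤
      eLpNorm (schwartzMul (u N) (dilBlock M 1 f k)) A₂.p volume) := by
    intro N
    by_cases hN : N = 0
    · exact ⟨N + L, le_rfl, fun h => absurd hN h⟩
    · have hne : u N 0 ≠ 0 := by
        rw [hu]
        exact mul_ne_zero (Nat.cast_ne_zero.mpr hN) h0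
      obtain ⟨k, hk1, hk2⟩ := ((eventually_ge_atTop (N + L)).and
        (eventually_le_eLpNorm_mul_dilBlock M (f := f) hne 1 A₂.p)).exists
      exact ⟨k, hk1, fun _ => hk2⟩
  choose k hk hlow using hex
  have key := h.exponent_le_of_card (f := u)
    (g := fun N => weightFactor (A₁.s - M.total * A₁.recip) (k N) • dilBlock M 1 f (k N))
    (α := α) (β := 0) (γ := 1) hC₀ (eLpNorm_schwartz_ne_top f A₁.p) hc
    (fun N hN => by
      simpa only [Finset.card_range] using hb₀ (Finset.range N) (by simpa using hN))
    (fun N hN => le_of_eq ?_) (fun N hN => ?_)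
  · simpa using key
  · rw [spaceNorm_of_core M Ψ A₁
      ((spectrumIn_dilBlock_core M (by simp) (spectrum_wide hf) _).const_smul _)]
    have h2 : (⇑(weightFactor (A₁.s - M.total * A₁.recip) (k N) • dilBlock M 1 f (k N)) :
        EuclideanSpace ℝ (Fin n) → ℂ) =
        weightFactor (A₁.s - M.total * A₁.recip) (k N) • ⇑(dilBlock M 1 f (k N)) := rfl
    rw [h2, eLpNorm_const_smul, enorm_weightFactor, eLpNorm_dilBlock, ← mul_assoc, ← mul_assoc,
      two_rpow_mul, two_rpow_mul, A₁.recip_eq, ENNReal.rpow_zero]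
    congr 1
    convert ENNReal.rpow_zero
    ring
  · have hspec : SpectrumIn (schwartzMul (u N) (dilBlock M 1 f (k N))) (M.core (k N)) := by
      rw [schwartzMul_blockSum_left]
      refine SpectrumIn.sum fun l hl => SpectrumIn.const_smul ?_ _
      dsimp only
      rw [schwartzMul_comm]
      have := Finset.mem_range.mp hl
      have := hk N
      exact SpectrumIn.mul_far (by simp) (by simp) hL (by omega) (spectrumIn_dilBlock M hf _)
        (spectrumIn_dilBlock M hf l)
    have h2 : schwartzMul (u N) (weightFactor (A₁.s - M.total * A₁.recip) (k N) •
        dilBlock M 1 f (k N)) = weightFactor (A₁.s - M.total * A₁.recip) (k N) •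
          schwartzMul (u N) (dilBlock M 1 f (k N)) := by
      have := schwartzMul_smul 1 (weightFactor (A₁.s - M.total * A₁.recip) (k N)) (u N)
        (dilBlock M 1 f (k N))
      rwa [one_smul, one_mul] at this
    have h3 : (⇑(weightFactor (A₁.s - M.total * A₁.recip) (k N) •
        schwartzMul (u N) (dilBlock M 1 f (k N))) : EuclideanSpace ℝ (Fin n) → ℂ) =
        weightFactor (A₁.s - M.total * A₁.recip) (k N) •
          ⇑(schwartzMul (u N) (dilBlock M 1 f (k N))) := rfl
    rw [h2, spaceNorm_of_core M Ψ A₂ (hspec.const_smul _), h3, eLpNorm_const_smul,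
      enorm_weightFactor, ← mul_assoc ((2 : ℝ≥0∞) ^ (A₂.s * (k N : ℝ))), two_rpow_mul, ← hs]
    refine le_trans (le_of_eq ?_) (mul_le_mul_right (hlow N hN) _)
    have h4 : ‖u N 0‖ₑ / 2 = N * (‖f 0‖ₑ / 2) := by
      rw [hu, enorm_mul, mul_div_assoc]
      congr 1
      simp [← ofReal_norm]
    rw [mul_left_comm (‖u N 0‖ₑ / 2), ← mul_assoc (2 ^ _) (2 ^ _), two_rpow_mul, A₂.recip_eq, h4,
      ENNReal.rpow_one, ← mul_assoc (N : ℝ≥0∞)]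
    convert (one_mul _).symm
    convert ENNReal.rpow_zero
    ring

theorem exists_bound_of_besov {A : SpaceParams} (hA : A.scale = Scale.B) {σ : ℝ} (hσ : |σ| = 1)
    (f : 𝓢(EuclideanSpace ℝ (Fin n), ℂ)) (hf : SpectrumIn f (M.patch 0 0 (3 * M.radius))) :
    ∃ C : ℝ≥0∞, C ≠ ⊤ ∧ ∀ J : Finset ℕ, J.Nonempty → spaceNorm M Ψ A
      (blockSum (A.s - M.total * A.recip) J (dilBlock M σ f)) ≤
        (J.card : ℝ≥0∞) ^ (A.q⁻¹).toReal * C :=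
  ⟨_, eLpNorm_schwartz_ne_top f A.p, fun _ hJ => (spaceNorm_dilSum_besov M Ψ hA hσ hJ hf).le⟩

/-! ### From real reciprocals back to exponents in `(0, ∞]` -/

theorem inv_toReal_le_iff {a b : ℝ≥0∞} (ha : 0 < a) (hb : 0 < b) :
    (a⁻¹).toReal ≤ (b⁻¹).toReal ↔ b ≤ a := by
  rw [ENNReal.toReal_le_toReal (ENNReal.inv_ne_top.mpr ha.ne') (ENNReal.inv_ne_top.mpr hb.ne'),
    ENNReal.inv_le_inv]

theorem one_le_inv_toReal_iff {a : ℝ≥0∞} (ha : 0 < a) : 1 ≤ (a⁻¹).toReal ↔ a ≤ 1 := by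
  rw [← inv_toReal_le_iff one_pos ha]
  simp

theorem one_le_inv_add_inv {a b : ℝ≥0∞} (ha : 0 < a) (hb : 0 < b)
    (h : 1 ≤ (a⁻¹).toReal + (b⁻¹).toReal) : a⁻¹ + b⁻¹ ≥ 1 := by
  have ha' := ENNReal.inv_ne_top.mpr ha.ne'
  have hb' := ENNReal.inv_ne_top.mpr hb.ne'
  rw [← ENNReal.toReal_add ha' hb', ← ENNReal.toReal_one,
    ENNReal.toReal_le_toReal (by simp) (ENNReal.add_ne_top.mpr ⟨ha', hb'⟩)] at h
  exact h

end Necessity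

end

/-! ### Assembly of the necessary conditions -/

theorem mainTheorem2 {n : ℕ} (M : AnisotropicWeight n) (Ψ : DyadicCutoff)
    (A₀ A₁ A₂ : SpaceParams)
    (h :
      -- the pointwise product of Schwartz functions satisfies the estimate
      (∃ c : ℝ≥0, ∀ f g : 𝓢(EuclideanSpace ℝ (Fin n), ℂ),
        spaceNorm M Ψ A₂ (schwartzMul f g) ≤ c * spaceNorm M Ψ A₀ f * spaceNorm M Ψ A₁ g) ∨
      -- the product `π` satisfies the estimate
      (∃ c : ℝ≥0, ∀ (f g : 𝓢(EuclideanSpace ℝ (Fin n), ℂ))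
        (w : 𝓢'(EuclideanSpace ℝ (Fin n), ℂ)), IsProduct M f g w →
        spaceNorm M Ψ A₂ w ≤ c * spaceNorm M Ψ A₀ f * spaceNorm M Ψ A₁ g)) :
    -- (1)
    A₀.s + A₁.s ≥ M.total * (A₀.recip + A₁.recip - 1) ∧
    -- (2)
    A₀.s + A₁.s ≥ 0 ∧
    -- (3)
    A₂.s ≤ min A₀.s A₁.s ∧
    -- (4)
    A₂.recip ≤ A₀.recip + A₁.recip ∧
    -- (5)
    A₂.s - M.total * A₂.recip ≤
      min (A₀.s - M.total * A₀.recip) (A₁.s - M.total * A₁.recip) ∧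
    -- (6)
    A₂.s - M.total * A₂.recip ≤ A₀.s + A₁.s - M.total * (A₀.recip + A₁.recip) ∧
    -- (7)
    (A₂.s - M.total * A₂.recip = A₁.s - M.total * A₁.recip →
      A₀.s = M.total * A₀.recip →
      (A₀.scale = Scale.B → A₀.q ≤ 1) ∧ (A₀.scale = Scale.F → A₀.p ≤ 1)) ∧
    -- (1')
    (A₀.s + A₁.s = M.total * A₀.recip + M.total * A₁.recip - M.total →
      (A₀.scale = Scale.B → A₁.scale = Scale.B → A₀.q⁻¹ + A₁.q⁻¹ ≥ 1) ∧
      (A₀.scale = Scale.B → A₁.scale = Scale.F → A₀.q⁻¹ + A₁.p⁻¹ ≥ 1)) ∧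
    -- (2')
    (A₀.s + A₁.s = 0 → A₀.q⁻¹ + A₁.q⁻¹ ≥ 1) ∧
    -- (3'), for `j = 0` and `j = 1`
    (A₂.s = A₀.s → A₂.q ≥ A₀.q) ∧
    (A₂.s = A₁.s → A₂.q ≥ A₁.q) ∧
    -- (5'), for `j = 0` and `j = 1`
    (A₂.s - M.total * A₂.recip = A₀.s - M.total * A₀.recip →
      A₀.scale = Scale.B → A₂.scale = Scale.B → A₂.q ≥ A₀.q) ∧
    (A₂.s - M.total * A₂.recip = A₁.s - M.total * A₁.recip →
      A₁.scale = Scale.B → A₂.scale = Scale.B → A₂.q ≥ A₁.q) ∧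
    -- (6')
    (A₂.s - M.total * A₂.recip =
        A₀.s - M.total * A₀.recip + A₁.s - M.total * A₁.recip →
      A₀.scale = Scale.B → A₁.scale = Scale.B → A₂.scale = Scale.B →
      A₂.q ≥ (A₀.q⁻¹ + A₁.q⁻¹)⁻¹) := by
  have hB : MulBound M Ψ A₀ A₁ A₂ := by
    rcases h with h | ⟨c, hc⟩
    · exact h
    · exact ⟨c, fun f g => hc f g _ (isProduct_schwartzMul M f g)⟩
  refine ⟨?_, hB.zero_le_add, le_min hB.smoothness_le hB.symm.smoothness_le, hB.recip_le,
    le_min hB.symm.differentialDimension_le hB.differentialDimension_le, ?_, ?_, ?_, ?_, ?_, ?_, ?_,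
    ?_, ?_⟩
  · have := hB.neg_total_le
    linarith
  · have := hB.differentialDimension_le_add
    linarith
  · intro hs hs₀
    -- The normalising weight of concentrated blocks in `A₀` is trivial here, so the unweighted sum
    -- has norm at most a multiple of `N^{1/q₀}` or `N^{1/p₀}`, depending on the scale.
    have h0 : A₀.s - M.total * A₀.recip = 0 := by linarith
    refine ⟨fun hA => ?_, fun hA => ?_⟩
    · rw [← one_le_inv_toReal_iff A₀.q_pos]
      refine hB.one_le_of_sum_bound hs fun f hf => ?_
      rw [← h0]
      exact exists_bound_of_besov hA (by simp) f hf
    · rw [← one_le_inv_toReal_iff A₀.p_pos]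
      refine hB.one_le_of_sum_bound hs fun f hf => ?_
      rw [← h0]
      exact exists_spaceNorm_dilSum_triebel_le M Ψ hA (by simp) hf
  · intro hs
    have hs' : (A₀.s - M.total * A₀.recip) + (A₁.s - M.total * A₁.recip) = -M.total := by linarith
    refine ⟨fun hA₀ hA₁ => one_le_inv_add_inv A₀.q_pos A₁.q_pos ?_,
      fun hA₀ hA₁ => one_le_inv_add_inv A₀.q_pos A₁.p_pos ?_⟩
    · exact hB.one_le_of_sum_bounds hs' (exists_bound_of_besov hA₀ (by simp))
        (exists_bound_of_besov hA₁ (by simp))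
    · exact hB.one_le_of_sum_bounds hs' (exists_bound_of_besov hA₀ (by simp))
        fun f hf => exists_spaceNorm_dilSum_triebel_le M Ψ hA₁ (by simp) hf
  · exact fun hs => one_le_inv_add_inv A₀.q_pos A₁.q_pos (hB.one_le_of_add_eq_zero hs)
  · exact fun hs => (inv_toReal_le_iff A₂.q_pos A₀.q_pos).mp (hB.inv_sum_exponent_le hs)
  · exact fun hs => (inv_toReal_le_iff A₂.q_pos A₁.q_pos).mp (hB.symm.inv_sum_exponent_le hs)
  · exact fun hs h₀ h₂ => (inv_toReal_le_iff A₂.q_pos A₀.q_pos).mp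
      (hB.symm.inv_sum_exponent_le_of_besov hs h₀ h₂)
  · exact fun hs h₁ h₂ => (inv_toReal_le_iff A₂.q_pos A₁.q_pos).mp
      (hB.inv_sum_exponent_le_of_besov hs h₁ h₂)
  · intro hs h₀ h₁ h₂
    have key := hB.inv_sum_exponent_le_add (by linarith) h₀ h₁ h₂
    have h0' := ENNReal.inv_ne_top.mpr A₀.q_pos.ne'
    have h1' := ENNReal.inv_ne_top.mpr A₁.q_pos.ne'
    rw [← ENNReal.toReal_add h0' h1', ENNReal.toReal_le_toReal
      (ENNReal.inv_ne_top.mpr A₂.q_pos.ne') (ENNReal.add_ne_top.mpr ⟨h0', h1'⟩)] at key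
    exact ENNReal.inv_le_iff_inv_le.mp key
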